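/- **Setting.** Let $1\le n\le N$ be integers and let $v\in\mathbb R^N$ be a fixed vector. Let $Y\in\mathbb R^{N\times n}$ be the random matrix whose first column is $v$ and whose other $n-1$ columns are i.i.d. $\mathcal N(0,\frac1N I_N)$ vectors. For an orthogonal matrix $Q\in\mathbb R^{n\times n}$ put $\tilde Y=YQ$, let $\tilde y_i^\top$ be the $i$-th row of $\tilde Y$, and let $$\tilde M=\sum_{i=1}^N\Big(\|\tilde y_i\|^2-\frac{n-1}{N}\Big)\tilde y_i\tilde y_i^\top-\frac3N I_n .$$ A leading eigenvector $\tilde u$ of $\tilde M$ is a unit eigenvector for an eigenvalue of largest absolute value. Here $\|\cdot\|$ is the Euclidean norm and $\|\cdot\|_p$ the $\ell_p$ norm. We say that *the spectral error is at most $r$* if, for every orthogonal $Q$ and every leading eigenvector $\tilde u$ of $\tilde M$, $\|\tilde Y\tilde u-v\|\le r$ up to a sign flip of $\tilde u$, i.e. $\min(\|\tilde Y\tilde u-v\|,\|{-\tilde Y\tilde u}-v\|)\le r$. **Theorem.** There is an absolute constant $N_0$ such that the following two statements hold for all $N\ge N_0$ and $1\le n\le N$. 1. (General form.) There are universal constants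 $C_0,C>0$ such that, for every $v\in\mathbb R^N$ with $\|v\|_4^4\ne\frac3N$ and every $\delta\in(0,1)$ with $N\ge\log^7(N/\delta)$, with probability at least $1-\delta$ the spectral error is at most $$C\cdot\eta\cdot\frac{\|v\|+1}{\big|\|v\|_4^4-\frac3N\big|},$$ where $$\eta=C_0\bigg((\|v\|+1)\frac{n\sqrt{\log(N/\delta)}}{N^{3/2}}+\|v\|_4^2\frac{\sqrt{n\log(N/\delta)}}{N}+\|v\|_6^3\frac{\sqrt n+\sqrt{\log(N/\delta)}}{\sqrt N}+\|v\|_\infty^2\frac{n\log(N/\delta)+\log^2(N/\delta)}{N}+\frac{(n\log(N/\delta))^{3/2}}{N^2}+\frac1N\big|\|v\|^2-1\big|\bigg).$$ 2. (Unit vectors.) There are a universal constant $A>0$ and a function $w:\mathbb N\to\mathbb R$ with $w(N)\to\infty$ as $N\to\infty$ such that, for every $c>0$ and every $v\in\mathbb R^N$ with $\|v\|=1$ and $\big|\|v\|_4^4-\frac3N\big|\ge\frac cN$, with probability at least $1-N^{-w(N)}$ the spectral error is at most $$\Big(1+\frac1c\Big)(\log N)^A\bigg(\frac1{\|v\|_4^4}\frac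 n{N^{3/2}}+\frac{\|v\|_\infty}{\|v\|_4^2}\sqrt{\frac nN}\bigg).$$ The constants $N_0,C_0,C,A$ and the function $w$ do not depend on $N,n,v,\delta,c$. -/

import Mathlib

open MeasureTheory ProbabilityTheory Filter
open scoped ENNReal NNReal Matrix

noncomputable section

namespace PlantedVector

/-- The `ℓ_p` norm of a vector of `ℝ^N`, for `p ∈ {1, 2, …, ∞}`. -/
def ellNorm {N : ℕ} (p : ℝ≥0∞) (v : EuclideanSpace ℝ (Fin N)) : ℝ :=
  ‖WithLp.toLp p (WithLp.ofLp v)‖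

/-- The random `N × n` matrix `Y` is a Gaussian basis with planted vector `v`: its first column
is `v`, and the entries of its other `n - 1` columns are i.i.d. `𝒩(0, 1/N)` (that is, these
columns are i.i.d. `𝒩(0, (1/N) I_N)` vectors). -/
structure IsGaussianBasis {Ω : Type*} [MeasurableSpace Ω] (P : Measure Ω) {N n : ℕ}
    (v : EuclideanSpace ℝ (Fin N)) (Y : Ω → Matrix (Fin N) (Fin n) ℝ) : Prop where
  first_col : ∀ (ω : Ω) (i : Fin N) (j : Fin n), (j : ℕ) = 0 → Y ω i j = v i
  law_entry : ∀ (i : Fin N) (j : Fin n), (j : ℕ) ≠ 0 →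
    HasLaw (fun ω => Y ω i j) (gaussianReal 0 (1 / (N : ℝ≥0))) P
  indep : iIndepFun
    (fun (p : Fin N × {j : Fin n // (j : ℕ) ≠ 0}) ω => Y ω p.1 (p.2 : Fin n)) P

/-- The `n × n` matrix `∑ᵢ (‖yᵢ‖² - (n-1)/N) yᵢ yᵢᵀ - (3/N) Iₙ`, where `yᵢᵀ` is the `i`-th row
of the `N × n` matrix `Y`. -/
def spectralMatrix {N n : ℕ} (Y : Matrix (Fin N) (Fin n) ℝ) : Matrix (Fin n) (Fin n) ℝ :=
  ∑ i, (‖WithLp.toLp 2 (Y i)‖ ^ 2 - ((n : ℝ) - 1) / N) • Matrix.vecMulVec (Y i) (Y i)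
    - (3 / (N : ℝ)) • (1 : Matrix (Fin n) (Fin n) ℝ)

/-- `u` is a leading eigenvector of `M`: a unit eigenvector for an eigenvalue of `M` that has the
largest magnitude among the eigenvalues of `M`. -/
def IsLeadingEigenvector {n : ℕ} (M : Matrix (Fin n) (Fin n) ℝ)
    (u : EuclideanSpace ℝ (Fin n)) : Prop :=
  ‖u‖ = 1 ∧ ∃ l : ℝ, M *ᵥ WithLp.ofLp u = l • WithLp.ofLp u ∧
    ∀ μ : ℝ, Module.End.HasEigenvalue (Matrix.toLin' M) μ → |μ| ≤ |l|

/-- The matrix-vector product `Y u`, as a vector of the Euclidean space `ℝ^N`. -/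
def estimator {N n : ℕ} (Y : Matrix (Fin N) (Fin n) ℝ) (u : EuclideanSpace ℝ (Fin n)) :
    EuclideanSpace ℝ (Fin N) :=
  WithLp.toLp 2 (Y *ᵥ WithLp.ofLp u)

/-- Whatever the orthogonal matrix `Q` is, the spectral estimator computed from the observation
`Y Q` is within Euclidean distance `r` of `v`, up to a sign flip of the leading eigenvector
(and whichever leading eigenvector is used). -/
def SpectralErrorLE {N n : ℕ} (Y : Matrix (Fin N) (Fin n) ℝ) (v : EuclideanSpace ℝ (Fin N))
    (r : ℝ) : Prop :=
  ∀ Q ∈ Matrix.orthogonalGroup (Fin n) ℝ, ∀ u : EuclideanSpace ℝ (Fin n),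
    IsLeadingEigenvector (spectralMatrix (Y * Q)) u →
      ‖estimator (Y * Q) u - v‖ ≤ r ∨ ‖estimator (Y * Q) (-u) - v‖ ≤ r

/-- The quantity `η(N, n, v, δ)`, with its universal constant `C₀` made explicit. -/
def eta (C₀ : ℝ) {N : ℕ} (n : ℕ) (v : EuclideanSpace ℝ (Fin N)) (δ : ℝ) : ℝ :=
  C₀ * ((‖v‖ + 1) * (n * √(Real.log (N / δ)) / (N : ℝ) ^ (3 / 2 : ℝ))
    + ellNorm 4 v ^ 2 * (√(n * Real.log (N / δ)) / N)
    + ellNorm 6 v ^ 3 * ((√n + √(Real.log (N / δ))) / √N)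
    + ellNorm ∞ v ^ 2 * ((n * Real.log (N / δ) + Real.log (N / δ) ^ 2) / N)
    + (n * Real.log (N / δ)) ^ (3 / 2 : ℝ) / (N : ℝ) ^ 2
    + 1 / N * |‖v‖ ^ 2 - 1|)

end PlantedVector

end

/-! Write row i of Y as (vᵢ, hᵢ/√N) with hᵢ standard Gaussian in ℝ^(n-1), and put gᵢ = ‖hᵢ‖² -
(n-1). The weight of row i in the spectral matrix M is then vᵢ² + gᵢ/N. Expand M along the planted
coordinate e and the Gaussian coordinates. The corner is ‖v‖₄⁴ - 3/N plus noise, the off-diagonal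
blocks have mean zero, and since E[g h hᵀ] = 2I the Gaussian block has mean (‖v‖² + 2 - 3)/N times
I. So the shift 3/N cancels that block up to (‖v‖² - 1)/N, and M = θ e eᵀ + error with θ = ‖v‖₄⁴ -
3/N (`dotProduct_spectralMatrix_eq`).

The summands of η control the operator norm of the error up to a constant
(`abs_form_sub_le_of_goodRows`). A rank-one perturbation argument
(`IsLeadingEigenvector.norm_sub_single_le`) places every leading eigenvector within 4ε/|θ| of ±e,
where ε bounds the error. Since Y e = v and ‖Y‖ is at most a multiple of ‖v‖ + 1, the estimator
inherits this bound. An orthogonal Q only conjugates M, so it changes nothing.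

The probabilistic core is `measureReal_not_goodRows_le`: each noise term is a sum over independent
rows, bounded by Bernstein's inequality at the points of a net of the sphere. The products g⟨u,h⟩
and g⟨u,h⟩² have tails too heavy for this, so g is first truncated at a level W that, with high
probability, no row exceeds. After truncation the exponential moments are finite on the scale 1/W,
while the variance proxy remains of order n (`integral_expDominator`). The bias caused by truncation
is negligible.

For unit vectors the failure probability is δ = N^(-log N). Then either the claimed bound exceeds
the trivial bound on the error, or η/‖v‖₄⁴ reduces to the two simplified terms
(`Scales.η_le_of_unit`), and the logarithms and constants are absorbed into (log N)⁵. -/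

namespace PlantedVector

/-! ### Bernstein-type moment generating function bounds -/

/-- The moment generating function of `f` at `t` is at most `exp (t² a)` whenever `|t| b ≤ 1`. -/
def HasBernsteinMGF {E : Type*} [MeasurableSpace E] (μ : Measure E) (f : E → ℝ) (a b : ℝ) : Prop :=
  ∀ t : ℝ, |t| * b ≤ 1 →
    Integrable (fun x => Real.exp (t * f x)) μ ∧
      ∫ x, Real.exp (t * f x) ∂μ ≤ Real.exp (t ^ 2 * a)

namespace HasBernsteinMGF

variable {E : Type*} [MeasurableSpace E] {μ : Measure E} {f : E → ℝ} {a b : ℝ}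

theorem mono (h : HasBernsteinMGF μ f a b) {a' b' : ℝ} (ha : a ≤ a') (hb : b ≤ b') :
    HasBernsteinMGF μ f a' b' := fun t ht => by
  have := h t (le_trans (by gcongr) ht)
  exact ⟨this.1, this.2.trans (by gcongr)⟩

theorem const_mul (h : HasBernsteinMGF μ f a b) (c : ℝ) :
    HasBernsteinMGF μ (fun x => c * f x) (c ^ 2 * a) (|c| * b) := fun t ht => by
  have := h (t * c) (by rw [abs_mul]; linarith)
  simp only [mul_assoc] at this ⊢
  refine ⟨this.1, this.2.trans_eq ?_⟩
  congr 1; ring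

theorem neg (h : HasBernsteinMGF μ f a b) : HasBernsteinMGF μ (fun x => -f x) a b := by
  simpa using h.const_mul (-1)

theorem map_iff {F : Type*} [MeasurableSpace F] {ν : Measure F} {g : F → E}
    (hg : AEMeasurable g ν) (hf : Measurable f) :
    HasBernsteinMGF (ν.map g) f a b ↔ HasBernsteinMGF ν (fun x => f (g x)) a b := by
  refine forall_congr' fun t => forall_congr' fun _ => ?_
  have hm : AEStronglyMeasurable (fun x => Real.exp (t * f x)) (ν.map g) := by
    apply Measurable.aestronglyMeasurable; fun_prop
  rw [integrable_map_measure hm hg, integral_map hg hm]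
  rfl

theorem sum_pi {ι : Type*} [Fintype ι] [IsProbabilityMeasure μ] {f : ι → E → ℝ} {a : ι → ℝ}
    (h : ∀ i, HasBernsteinMGF μ (f i) (a i) b) :
    HasBernsteinMGF (Measure.pi fun _ : ι => μ) (fun x => ∑ i, f i (x i)) (∑ i, a i) b :=
  fun t ht => by
  simp only [Finset.mul_sum, Real.exp_sum]
  refine ⟨Integrable.fintype_prod (f := fun i x => Real.exp (t * f i x))
    fun i => (h i t ht).1, ?_⟩
  rw [integral_fintype_prod_eq_prod (fun i x => Real.exp (t * f i x))]
  exact Finset.prod_le_prod (fun i _ => integral_nonneg fun x => (Real.exp_pos _).le)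
    fun i _ => (h i t ht).2

theorem measureReal_ge_le [IsProbabilityMeasure μ] (h : HasBernsteinMGF μ f a b) (ha : 0 ≤ a)
    (hb : 0 ≤ b) {s x : ℝ} (hs : 0 < s) (hx : 0 < x) (hsx : 2 * √(a * s) + b * s ≤ x) :
    μ.real {y | x ≤ f y} ≤ Real.exp (-s) := by
  -- Chernoff parameter: the optimal t = √(s/a) if it satisfies t b ≤ 1, and the endpoint 1/b
  -- otherwise. If a = b = 0 every t is allowed and s/x suffices.
  obtain ⟨t, ht, htb, hts⟩ : ∃ t : ℝ, 0 ≤ t ∧ t * b ≤ 1 ∧ -t * x + t ^ 2 * a ≤ -s := by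
    rcases ha.eq_or_lt with rfl | ha'
    · rcases hb.eq_or_lt with rfl | hb'
      · refine ⟨s / x, by positivity, by simp, ?_⟩
        field_simp; simp
      · refine ⟨1 / b, by positivity, by field_simp; simp, ?_⟩
        simp only [zero_mul, Real.sqrt_zero, mul_zero, zero_add, add_zero] at hsx ⊢
        rw [neg_mul, neg_le_neg_iff, one_div, inv_mul_eq_div, le_div_iff₀ hb']
        linarith
    · set q := √(a * s) with hq
      have hq2 : q ^ 2 = a * s := Real.sq_sqrt (by positivity)
      have hq0 : 0 < q := Real.sqrt_pos.2 (by positivity)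
      by_cases hc : q * b ≤ a
      · refine ⟨q / a, by positivity, by rw [div_mul_eq_mul_div, div_le_one ha']; exact hc, ?_⟩
        have h1 : q / a * (2 * q) ≤ q / a * x := by
          apply mul_le_mul_of_nonneg_left _ (by positivity)
          nlinarith
        have h2 : q / a * (2 * q) = 2 * s := by field_simp; linarith
        have h3 : (q / a) ^ 2 * a = s := by field_simp; linarith
        linarith
      · push Not at hc
        have hb' : 0 < b := by
          rcases hb.eq_or_lt with rfl | hb'
          · simp at hc; linarith
          · exact hb'
        refine ⟨1 / b, by positivity, by field_simp; simp, ?_⟩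
        have h1 : 1 / b * (2 * q + b * s) ≤ 1 / b * x :=
          mul_le_mul_of_nonneg_left hsx (by positivity)
        have h2 : 1 / b * (2 * q + b * s) = 2 * (q / b) + s := by field_simp
        have h3 : (1 / b) ^ 2 * a ≤ q / b := by
          rw [one_div, inv_pow, inv_mul_eq_div, div_le_div_iff₀ (by positivity) hb']
          nlinarith
        have h4 : 0 ≤ q / b := by positivity
        linarith
  have key := h t (by rwa [abs_of_nonneg ht])
  refine (measure_ge_le_exp_mul_mgf x ht key.1).trans ?_
  calc Real.exp (-t * x) * mgf f μ t ≤ Real.exp (-t * x) * Real.exp (t ^ 2 * a) :=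
        mul_le_mul_of_nonneg_left key.2 (Real.exp_pos _).le
    _ = Real.exp (-t * x + t ^ 2 * a) := (Real.exp_add _ _).symm
    _ ≤ _ := Real.exp_le_exp.2 hts

theorem measureReal_abs_ge_le [IsProbabilityMeasure μ] (h : HasBernsteinMGF μ f a b) (ha : 0 ≤ a)
    (hb : 0 ≤ b) {s x : ℝ} (hs : 0 < s) (hx : 0 < x) (hsx : 2 * √(a * s) + b * s ≤ x) :
    μ.real {y | x ≤ |f y|} ≤ 2 * Real.exp (-s) := by
  have : {y | x ≤ |f y|} ⊆ {y | x ≤ f y} ∪ {y | x ≤ -f y} := fun y hy => by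
    simpa [le_abs] using hy
  refine (measureReal_mono this).trans ((measureReal_union_le _ _).trans ?_)
  linarith [h.measureReal_ge_le ha hb hs hx hsx, h.neg.measureReal_ge_le ha hb hs hx hsx]

/-- A bounded-second-moment criterion: a Taylor expansion of the exponential gives a Bernstein
bound for the centred variable. -/
theorem sub_integral [IsProbabilityMeasure μ] (hf : Measurable f) (hfi : Integrable f μ)
    {g : E → ℝ} (hg : Integrable g μ) (hga : ∫ x, g x ∂μ ≤ a)
    (hfg : ∀ t x, |t| * b ≤ 1 → f x ^ 2 * Real.exp |t * f x| ≤ g x)  :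
    HasBernsteinMGF μ (fun x => f x - ∫ y, f y ∂μ) a b := fun t ht => by
  set c := ∫ y, f y ∂μ with hc
  have hpt : ∀ x, Real.exp (t * f x) ≤ 1 + t * f x + t ^ 2 * g x := fun x => by
    -- Second-order Taylor remainder: |e^z - 1 - z| ≤ z² e^|z|.
    have h1 : Real.exp (t * f x) ≤ 1 + t * f x + (t * f x) ^ 2 * Real.exp |t * f x| := by
      have := Complex.norm_exp_sub_sum_le_norm_mul_exp ((t * f x : ℝ) : ℂ) 2
      simp only [Finset.sum_range_succ, Finset.sum_range_zero, pow_zero, pow_one,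
        Nat.factorial_zero, Nat.factorial_one, Nat.cast_one, div_one, zero_add,
        Complex.norm_real, Real.norm_eq_abs, sq_abs] at this
      norm_cast at this
      rw [Real.norm_eq_abs] at this
      linarith [(abs_le.1 this).2]
    have h2 := hfg t x ht
    have h3 : (t * f x) ^ 2 * Real.exp |t * f x| ≤ t ^ 2 * g x := by
      rw [mul_pow, mul_assoc]; gcongr
    linarith
  have hd : Integrable (fun x => 1 + t * f x + t ^ 2 * g x) μ := by fun_prop
  have hi : Integrable (fun x => Real.exp (t * f x)) μ := by
    refine hd.mono' (Measurable.aestronglyMeasurable (by fun_prop)) (ae_of_all _ fun x => ?_)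
    rw [Real.norm_eq_abs, Real.abs_exp]; exact hpt x
  have he : ∀ x, Real.exp (t * (f x - c)) = Real.exp (t * f x) * Real.exp (-(t * c)) := fun x => by
    rw [← Real.exp_add]; ring_nf
  simp only [he]
  refine ⟨hi.mul_const _, ?_⟩
  rw [integral_mul_const]
  have h4 : ∫ x, Real.exp (t * f x) ∂μ ≤ Real.exp (t * c + t ^ 2 * a) := by
    calc ∫ x, Real.exp (t * f x) ∂μ ≤ ∫ x, (1 + t * f x + t ^ 2 * g x) ∂μ :=
          integral_mono hi hd hpt
      _ = 1 + t * c + t ^ 2 * ∫ x, g x ∂μ := by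
          rw [integral_add (by fun_prop) (by fun_prop), integral_add (by fun_prop) (by fun_prop),
            integral_const_mul, integral_const_mul]; simp [hc]
      _ ≤ (t * c + t ^ 2 * a) + 1 := by nlinarith [sq_nonneg t]
      _ ≤ _ := Real.add_one_le_exp _
  calc _ ≤ Real.exp (t * c + t ^ 2 * a) * Real.exp (-(t * c)) := by gcongr
    _ = _ := by rw [← Real.exp_add]; ring_nf

end HasBernsteinMGF


/-! ### Moments of the standard Gaussian distribution -/

/-- The left side is the moment generating function of X² - 1 for a standard Gaussian X. After
squaring, the claim is 1 ≤ e^(2t+4t²)(1 - 2t). For t ≤ 0 this follows from e^z ≥ 1 + z, since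
(1+2t+4t²)(1-2t) = 1 - 8t³; for t ≥ 0 the quadratic term of the exponential is needed as well. -/
theorem one_div_sqrt_mul_exp_le {t : ℝ} (ht : |t| ≤ 1 / 4) :
    Real.exp (-t) * (1 / √(1 - 2 * t)) ≤ Real.exp (2 * t ^ 2) := by
  obtain ⟨h1, h2⟩ := abs_le.1 ht
  have hpos : 0 < 1 - 2 * t := by linarith
  have key : 1 ≤ Real.exp (2 * t + 4 * t ^ 2) * (1 - 2 * t) := by
    rcases le_total 0 t with h0 | h0
    · have := Real.quadratic_le_exp_of_nonneg (x := 2 * t + 4 * t ^ 2) (by positivity)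
      refine le_trans ?_ (mul_le_mul_of_nonneg_right this hpos.le)
      have : 0 ≤ t ^ 2 * ((1 + 2 * t) * (1 - 4 * t ^ 2) - 4 * t) := by
        apply mul_nonneg (sq_nonneg t)
        nlinarith [mul_nonneg h0 (sub_nonneg.2 h2), mul_nonneg h0 (mul_nonneg h0 (sub_nonneg.2 h2))]
      nlinarith
    · have := Real.add_one_le_exp (2 * t + 4 * t ^ 2)
      refine le_trans ?_ (mul_le_mul_of_nonneg_right this hpos.le)
      nlinarith [mul_nonneg (sq_nonneg t) (neg_nonneg.2 h0)]
  rw [mul_one_div, div_le_iff₀ (Real.sqrt_pos.2 hpos)]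
  have h3 : Real.exp (2 * t ^ 2) * √(1 - 2 * t) * Real.exp t
      = √(Real.exp (2 * t + 4 * t ^ 2) * (1 - 2 * t)) := by
    rw [Real.sqrt_mul (Real.exp_pos _).le, ← Real.exp_half, mul_right_comm, ← Real.exp_add]
    ring_nf
  have h4 : 1 ≤ Real.exp (2 * t ^ 2) * √(1 - 2 * t) * Real.exp t := by
    rw [h3]; exact Real.one_le_sqrt.2 key
  rw [Real.exp_neg, inv_le_iff_one_le_mul₀ (Real.exp_pos _)]
  exact h4

theorem gaussianReal_exp_mul_sq {t : ℝ} (ht : t < 1 / 2) :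
    Integrable (fun x => Real.exp (t * x ^ 2)) (gaussianReal 0 1) ∧
      ∫ x, Real.exp (t * x ^ 2) ∂(gaussianReal 0 1) = 1 / √(1 - 2 * t) := by
  have hfun : ∀ x : ℝ, gaussianPDFReal 0 1 x * Real.exp (t * x ^ 2)
      = (√(2 * Real.pi))⁻¹ * Real.exp (-(1 / 2 - t) * x ^ 2) := fun x => by
    rw [gaussianPDFReal, mul_assoc, ← Real.exp_add]
    simp; left; ring
  constructor
  · rw [gaussianReal_of_var_ne_zero 0 one_ne_zero, integrable_withDensity_iff_integrable_smul₀'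
      (measurable_gaussianPDF 0 1).aemeasurable (ae_of_all _ fun x => gaussianPDF_lt_top)]
    simp only [toReal_gaussianPDF, smul_eq_mul, hfun]
    exact (integrable_exp_neg_mul_sq (by linarith)).const_mul _
  · rw [integral_gaussianReal_eq_integral_smul one_ne_zero]
    simp only [smul_eq_mul, hfun]
    rw [integral_const_mul, integral_gaussian, ← Real.sqrt_inv, ← Real.sqrt_mul (by positivity),
      ← Real.sqrt_one, ← Real.sqrt_div (by simp)]
    congr 1
    have : 1 - 2 * t ≠ 0 := by linarith
    have : 1/2 - t ≠ 0 := by linarith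
    rw [Real.sqrt_one]
    field_simp

theorem hasBernsteinMGF_sq_sub_one :
    HasBernsteinMGF (gaussianReal 0 1) (fun x => x ^ 2 - 1) 2 4 := fun t ht => by
  have ht' : |t| ≤ 1 / 4 := by linarith
  have h := gaussianReal_exp_mul_sq (t := t) (by linarith [(abs_le.1 ht').2])
  have he : ∀ x : ℝ, Real.exp (t * (x ^ 2 - 1)) = Real.exp (-t) * Real.exp (t * x ^ 2) :=
    fun x => by rw [← Real.exp_add]; ring_nf
  simp only [he]
  refine ⟨h.1.const_mul _, ?_⟩
  rw [integral_const_mul, h.2, mul_comm (t ^ 2)]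
  exact one_div_sqrt_mul_exp_le ht'

theorem hasBernsteinMGF_id (v : ℝ≥0) :
    HasBernsteinMGF (gaussianReal 0 v) (fun x => x) (v / 2) 0 := fun t _ => by
  refine ⟨integrable_exp_mul_gaussianReal t, ?_⟩
  have := congrFun (mgf_fun_id_gaussianReal (μ := 0) (v := v)) t
  simp only [mgf] at this
  rw [this]
  apply le_of_eq; congr 1; ring

theorem integrable_pow_gaussianReal (n : ℕ) (v : ℝ≥0) :
    Integrable (fun x : ℝ => x ^ n) (gaussianReal 0 v) := by
  have h : (0 : ℝ) ∈ interior (integrableExpSet (fun x => x) (gaussianReal 0 v)) := by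
    rw [integrableExpSet_fun_id_gaussianReal]; simp
  exact integrable_pow_of_mem_interior_integrableExpSet h n

theorem integral_pow_four_gaussianReal (v : ℝ≥0) :
    ∫ x, x ^ 4 ∂(gaussianReal 0 v) = 3 * (v : ℝ) ^ 2 := by
  have h : (0 : ℝ) ∈ interior (integrableExpSet (fun x => x) (gaussianReal 0 v)) := by
    rw [integrableExpSet_fun_id_gaussianReal]; simp
  have h4 := iteratedDeriv_mgf_zero h 4
  rw [mgf_fun_id_gaussianReal] at h4
  simp only [zero_mul, zero_add] at h4
  have e : ∀ t : ℝ, HasDerivAt (fun t : ℝ => Real.exp (v * t ^ 2 / 2))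
      (v * t * Real.exp (v * t ^ 2 / 2)) t := fun t => by
    have : HasDerivAt (fun t : ℝ => v * t ^ 2 / 2) (v * t) t := by
      have := ((hasDerivAt_pow 2 t).const_mul (v : ℝ)).div_const 2
      refine this.congr_deriv ?_
      norm_num; ring
    refine this.exp.congr_deriv ?_; ring
  have d1 : deriv (fun t : ℝ => Real.exp (v * t ^ 2 / 2))
      = fun t => v * t * Real.exp (v * t ^ 2 / 2) := funext fun t => (e t).deriv
  have d2 : deriv (fun t : ℝ => v * t * Real.exp (v * t ^ 2 / 2))
      = fun t => (v + v ^ 2 * t ^ 2) * Real.exp (v * t ^ 2 / 2) := funext fun t => by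
    have := (((hasDerivAt_id t).const_mul (v : ℝ)).mul (e t)).deriv
    refine Eq.trans this ?_
    simp; ring
  have d3 : deriv (fun t : ℝ => (v + v ^ 2 * t ^ 2) * Real.exp (v * t ^ 2 / 2))
      = fun t => (3 * v ^ 2 * t + v ^ 3 * t ^ 3) * Real.exp (v * t ^ 2 / 2) := funext fun t => by
    have := ((((hasDerivAt_pow 2 t).const_mul ((v : ℝ) ^ 2)).const_add (v : ℝ)).mul (e t)).deriv
    refine Eq.trans this ?_
    simp; ring
  have d4 : deriv (fun t : ℝ => (3 * v ^ 2 * t + v ^ 3 * t ^ 3) * Real.exp (v * t ^ 2 / 2)) 0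
      = 3 * (v : ℝ) ^ 2 := by
    have := ((((hasDerivAt_id (0 : ℝ)).const_mul (3 * (v : ℝ) ^ 2)).add
      ((hasDerivAt_pow 3 (0 : ℝ)).const_mul ((v : ℝ) ^ 3))).mul (e 0)).deriv
    refine Eq.trans this ?_
    simp
  rw [iteratedDeriv_succ, iteratedDeriv_succ, iteratedDeriv_succ, iteratedDeriv_one, d1, d2, d3,
    d4] at h4
  exact h4.symm

variable {E : Type*} [NormedAddCommGroup E] [InnerProductSpace ℝ E] [FiniteDimensional ℝ E]
  [MeasurableSpace E] [BorelSpace E]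

theorem stdGaussian_map_inner (u : E) :
    (stdGaussian E).map (fun x => inner ℝ u x) = gaussianReal 0 (‖u‖₊ ^ 2) := by
  have h := IsGaussian.map_eq_gaussianReal (μ := stdGaussian E) (innerSL ℝ u)
  rw [integral_strongDual_stdGaussian, variance_dual_stdGaussian, innerSL_apply_norm] at h
  refine h.trans ?_
  congr 1
  ext
  simp

theorem stdGaussian_map_neg : (stdGaussian E).map (fun x => -x) = stdGaussian E :=
  stdGaussian_map (LinearIsometryEquiv.neg ℝ (E := E))

theorem hasBernsteinMGF_inner (u : E) :
    HasBernsteinMGF (stdGaussian E) (fun x => inner ℝ u x) (‖u‖ ^ 2 / 2) 0 := by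
  have h := hasBernsteinMGF_id (‖u‖₊ ^ 2)
  rw [← stdGaussian_map_inner] at h
  simpa using (HasBernsteinMGF.map_iff (by fun_prop) (by fun_prop)).1 h

theorem hasBernsteinMGF_inner_sq {u : E} (hu : ‖u‖ = 1) :
    HasBernsteinMGF (stdGaussian E) (fun x => inner ℝ u x ^ 2 - 1) 2 4 := by
  have h := hasBernsteinMGF_sq_sub_one
  rw [show (1 : ℝ≥0) = ‖u‖₊ ^ 2 by ext; simp [hu], ← stdGaussian_map_inner] at h
  exact (HasBernsteinMGF.map_iff (f := fun x => x ^ 2 - 1) (by fun_prop) (by fun_prop)).1 h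

/-- The centred squared norm. -/
noncomputable def normSqDev {E : Type*} [NormedAddCommGroup E] [InnerProductSpace ℝ E] (x : E) : ℝ := ‖x‖ ^ 2 - Module.finrank ℝ E

omit [FiniteDimensional ℝ E] in
@[fun_prop]
theorem measurable_normSqDev : Measurable (normSqDev (E := E)) := by
  unfold normSqDev; fun_prop

omit [FiniteDimensional ℝ E] [MeasurableSpace E] [BorelSpace E] in
theorem normSqDev_neg (x : E) : normSqDev (-x) = normSqDev x := by simp [normSqDev]

theorem hasBernsteinMGF_normSqDev :
    HasBernsteinMGF (stdGaussian E) normSqDev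
      (2 * Module.finrank ℝ E) 4 := by
  rw [stdGaussian_eq_map_pi_orthonormalBasis (stdOrthonormalBasis ℝ E)]
  refine (HasBernsteinMGF.map_iff (Measurable.aemeasurable (by fun_prop)) (by fun_prop)).2 ?_
  have h := HasBernsteinMGF.sum_pi (ι := Fin (Module.finrank ℝ E))
    fun _ => hasBernsteinMGF_sq_sub_one
  have he : ∀ x : Fin (Module.finrank ℝ E) → ℝ,
      normSqDev (∑ i, x i • stdOrthonormalBasis ℝ E i) = ∑ i, (x i ^ 2 - 1) :=
    fun x => by
    rw [normSqDev, ← (stdOrthonormalBasis ℝ E).sum_sq_norm_inner_right]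
    simp [Finset.sum_sub_distrib, inner_sum, real_inner_smul_right,
      OrthonormalBasis.inner_eq_ite]
  simp only [he]
  refine h.mono (by simp [mul_comm]) le_rfl

theorem pow_four_le_exp (y : ℝ) : y ^ 4 ≤ 24 * (Real.exp y + Real.exp (-y)) := by
  have := Real.pow_div_factorial_le_exp |y| (abs_nonneg y) 4
  rw [Even.pow_abs (by decide)] at this
  norm_num [Nat.factorial] at this
  rcases abs_cases y with h | h <;> rw [h.1] at this <;>
    linarith [Real.exp_pos y, Real.exp_pos (-y)]

theorem exp_le_three_halves {x : ℝ} (hx : x ≤ 3 / 8) : Real.exp x ≤ 3 / 2 := by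
  refine (Real.exp_le_exp.2 hx).trans ?_
  have := Real.exp_one_lt_d9
  by_contra! h
  have h8 : Real.exp (3 / 8) ^ 8 = Real.exp 1 ^ 3 := by
    rw [← Real.exp_nat_mul, ← Real.exp_nat_mul]; norm_num
  have h1 : (3 / 2 : ℝ) ^ 8 < Real.exp (3 / 8) ^ 8 := by gcongr
  have h2 : Real.exp 1 ^ 3 ≤ (2.7182818286 : ℝ) ^ 3 := by gcongr
  rw [h8] at h1
  norm_num at h1 h2
  linarith

theorem integral_normSqDev_pow_four {n : ℕ} (hn : 1 ≤ n) (hE : Module.finrank ℝ E ≤ n) :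
    Integrable (fun x : E => normSqDev x ^ 4) (stdGaussian E) ∧
      ∫ x : E, normSqDev x ^ 4 ∂(stdGaussian E) ≤ 20000 * (n : ℝ) ^ 2 := by
  have hn' : (1 : ℝ) ≤ n := by exact_mod_cast hn
  have hE' : (Module.finrank ℝ E : ℝ) ≤ n := by exact_mod_cast hE
  -- The deviation lives on the scale √n; at this t the exponent 2t² dim E is at most 1/8, so both
  -- exponential moments are bounded by constants.
  set t : ℝ := 1 / (4 * √n) with ht
  have hs : 1 ≤ √(n : ℝ) := Real.one_le_sqrt.2 hn'
  have ht0 : 0 < t := by positivity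
  have ht4 : |t| * 4 ≤ 1 := by
    rw [abs_of_pos ht0, ht, div_mul_eq_mul_div, div_le_one (by positivity)]; linarith
  have ht2 : t ^ 2 = 1 / (16 * n) := by
    rw [ht, div_pow, mul_pow, Real.sq_sqrt (by positivity)]; norm_num
  have h1 := hasBernsteinMGF_normSqDev (E := E) t ht4
  have h2 := hasBernsteinMGF_normSqDev (E := E) (-t) (by simpa using ht4)
  have hexp : Real.exp (t ^ 2 * (2 * Module.finrank ℝ E)) ≤ 3 / 2 := by
    apply exp_le_three_halves
    rw [ht2, div_mul_eq_mul_div, one_mul, div_le_iff₀ (by positivity)]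
    linarith
  rw [neg_sq] at h2
  have hpt : ∀ x : E, normSqDev x ^ 4 ≤ 256 * (n : ℝ) ^ 2 *
      (24 * (Real.exp (t * normSqDev x) + Real.exp (-t * normSqDev x))) := fun x => by
    have h3 := pow_four_le_exp (t * normSqDev x)
    have h4 : normSqDev x ^ 4 = 256 * (n : ℝ) ^ 2 * (t * normSqDev x) ^ 4 := by
      rw [mul_pow, show t ^ 4 = (t ^ 2) ^ 2 by ring, ht2]; field_simp; ring
    rw [h4, neg_mul]
    gcongr
  have hi : Integrable (fun x : E => 256 * (n : ℝ) ^ 2 *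
      (24 * (Real.exp (t * normSqDev x) + Real.exp (-t * normSqDev x)))) (stdGaussian E) :=
    ((h1.1.add h2.1).const_mul 24).const_mul _
  have hi4 : Integrable (fun x : E => normSqDev x ^ 4) (stdGaussian E) :=
    hi.mono' (Measurable.aestronglyMeasurable (by fun_prop)) (ae_of_all _ fun x => by
      rw [Real.norm_eq_abs, abs_of_nonneg (by positivity)]; exact hpt x)
  refine ⟨hi4, (integral_mono hi4 hi hpt).trans ?_⟩
  rw [integral_const_mul, integral_const_mul, integral_add h1.1 h2.1]
  have := h1.2.trans hexp
  have := h2.2.trans hexp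
  nlinarith [sq_nonneg (n : ℝ)]

theorem pow_eight_mul_exp_le (y : ℝ) :
    y ^ 8 * Real.exp (y ^ 2 / 8) ≤ 98304 * Real.exp (y ^ 2 / 4) := by
  have := Real.pow_div_factorial_le_exp (y ^ 2 / 8) (by positivity) 4
  norm_num [Nat.factorial] at this
  rw [show y ^ 2 / 4 = y ^ 2 / 8 + y ^ 2 / 8 by ring, Real.exp_add, ← mul_assoc]
  gcongr
  linarith [show (y ^ 2 / 8) ^ 4 / 24 = y ^ 8 / 98304 by ring]

/-- The function dominating the exponential moments of the truncated products. -/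
noncomputable def expDominator {E : Type*} [NormedAddCommGroup E] [InnerProductSpace ℝ E]
    (u x : E) : ℝ :=
  normSqDev x ^ 2 * ((1 + inner ℝ u x ^ 4) * Real.exp (inner ℝ u x ^ 2 / 16))

/-- The order n, rather than a power of the truncation level, is what makes the Bernstein variance
sharp: the squared deviation has size n, and the Gaussian factor has bounded moments. -/
theorem integral_expDominator {n : ℕ} (hn : 1 ≤ n) (hE : Module.finrank ℝ E ≤ n)
    {u : E} (hu : ‖u‖ = 1) :
    Integrable (expDominator u) (stdGaussian E) ∧
      ∫ x : E, expDominator u x ∂(stdGaussian E) ≤ 2 * 10 ^ 5 * n := by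
  have hn' : (1 : ℝ) ≤ n := by exact_mod_cast hn
  have h4 := integral_normSqDev_pow_four (E := E) hn hE
  have hg := hasBernsteinMGF_inner_sq hu (1 / 4) (by norm_num [abs_of_pos])
  have he : ∀ x : E, Real.exp (1 / 4 * (inner ℝ u x ^ 2 - 1))
      = Real.exp (-(1 / 4)) * Real.exp (inner ℝ u x ^ 2 / 4) := fun x => by
    rw [← Real.exp_add]; ring_nf
  simp only [he] at hg
  rw [integral_const_mul] at hg
  have hgi : Integrable (fun x : E => Real.exp (inner ℝ u x ^ 2 / 4)) (stdGaussian E) := by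
    have := hg.1.const_mul (Real.exp (1 / 4))
    simpa [← mul_assoc, ← Real.exp_add] using this
  have hgb : ∫ x : E, Real.exp (inner ℝ u x ^ 2 / 4) ∂(stdGaussian E) ≤ 3 / 2 := by
    have := mul_le_mul_of_nonneg_left hg.2 (Real.exp_pos (1 / 4)).le
    rw [← mul_assoc, ← Real.exp_add, ← Real.exp_add] at this
    norm_num at this
    exact this.trans (exp_le_three_halves (by norm_num))
  have hpt : ∀ x : E, expDominator u x
      ≤ 1 / (2 * n) * normSqDev x ^ 4 + n / 2 * 196610 * Real.exp (inner ℝ u x ^ 2 / 4) :=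
    fun x => by
    have h1 := pow_eight_mul_exp_le (inner ℝ u x)
    set p := normSqDev x ^ 2
    set q := (1 + inner ℝ u x ^ 4) * Real.exp (inner ℝ u x ^ 2 / 16) with hq
    have hq2 : q ^ 2 ≤ 196610 * Real.exp (inner ℝ u x ^ 2 / 4) := by
      have h2 : q ^ 2 = (1 + inner ℝ u x ^ 4) ^ 2 * Real.exp (inner ℝ u x ^ 2 / 8) := by
        rw [hq, mul_pow, ← Real.exp_nat_mul]; ring_nf
      have h3 : Real.exp (inner ℝ u x ^ 2 / 8) ≤ Real.exp (inner ℝ u x ^ 2 / 4) :=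
        Real.exp_le_exp.2 (by linarith [sq_nonneg (inner ℝ u x)])
      have h4 : (1 + inner ℝ u x ^ 4) ^ 2 ≤ 2 + 2 * inner ℝ u x ^ 8 := by
        nlinarith [sq_nonneg (1 - inner ℝ u x ^ 4)]
      rw [h2]
      calc _ ≤ (2 + 2 * inner ℝ u x ^ 8) * Real.exp (inner ℝ u x ^ 2 / 8) := by gcongr
        _ = 2 * Real.exp (inner ℝ u x ^ 2 / 8)
            + 2 * (inner ℝ u x ^ 8 * Real.exp (inner ℝ u x ^ 2 / 8)) := by ring
        _ ≤ _ := by linarith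
    -- Weighted AM-GM: p² has mean of order n² and q² of order 1, so the weight 1/n balances the two
    -- contributions at order n.
    have h2 : p * q ≤ 1 / (2 * n) * p ^ 2 + n / 2 * q ^ 2 := by
      have : 0 ≤ 1 / (2 * n) * (p - n * q) ^ 2 := by positivity
      have h3 : 1 / (2 * n) * (p - n * q) ^ 2 = 1 / (2 * n) * p ^ 2 + n / 2 * q ^ 2 - p * q := by
        field_simp; ring
      linarith
    calc expDominator u x = p * q := rfl
      _ ≤ _ := h2
      _ ≤ 1 / (2 * n) * p ^ 2 + n / 2 * (196610 * Real.exp (inner ℝ u x ^ 2 / 4)) := by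
        gcongr
      _ = _ := by simp only [p]; ring
  have hi := (h4.1.const_mul (1 / (2 * (n : ℝ)))).add (hgi.const_mul ((n : ℝ) / 2 * 196610))
  have hi' : Integrable (expDominator u) (stdGaussian E) :=
    hi.mono' (Measurable.aestronglyMeasurable (by unfold expDominator; fun_prop))
      (ae_of_all _ fun x => by
        rw [Real.norm_eq_abs, abs_of_nonneg (by unfold expDominator; positivity)]; exact hpt x)
  refine ⟨hi', (integral_mono hi' hi hpt).trans ?_⟩
  simp only [Pi.add_apply]
  rw [integral_add (h4.1.const_mul _) (hgi.const_mul _), integral_const_mul, integral_const_mul]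
  have h5 : 1 / (2 * (n : ℝ)) * ∫ x : E, normSqDev x ^ 4 ∂(stdGaussian E) ≤ 10000 * n := by
    calc _ ≤ 1 / (2 * (n : ℝ)) * (20000 * (n : ℝ) ^ 2) := by gcongr; exact h4.2
      _ = _ := by field_simp; ring
  nlinarith

/-! ### Mixed moments -/

theorem integrable_inner_pow (u : E) (n : ℕ) :
    Integrable (fun x => inner ℝ u x ^ n) (stdGaussian E) := by
  have h := integrable_pow_gaussianReal n (‖u‖₊ ^ 2)
  rw [← stdGaussian_map_inner, integrable_map_measure (by fun_prop) (by fun_prop)] at h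
  exact h

theorem integral_inner_pow_four (u : E) :
    ∫ x, inner ℝ u x ^ 4 ∂(stdGaussian E) = 3 * ‖u‖ ^ 4 := by
  have h := integral_pow_four_gaussianReal (‖u‖₊ ^ 2)
  rw [← stdGaussian_map_inner, integral_map (by fun_prop) (by fun_prop)] at h
  rw [h]; push_cast; ring

theorem integral_inner_sq (u : E) :
    ∫ x, inner ℝ u x ^ 2 ∂(stdGaussian E) = ‖u‖ ^ 2 := by
  have h := variance_of_integral_eq_zero (X := fun x => inner ℝ u x) (μ := stdGaussian E)
    (by fun_prop) (integral_strongDual_stdGaussian (innerSL ℝ u))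
  rw [← h]
  have := variance_dual_stdGaussian (innerSL ℝ u)
  rw [innerSL_apply_norm] at this
  exact this

/-- Polarization: 12 a²b² = (a+b)⁴ + (a-b)⁴ - 2a⁴ - 2b⁴ reduces the mixed moment to fourth moments
of single linear forms. -/
theorem integral_inner_sq_mul_inner_sq (u v : E) :
    Integrable (fun x => inner ℝ u x ^ 2 * inner ℝ v x ^ 2) (stdGaussian E) ∧
    ∫ x, inner ℝ u x ^ 2 * inner ℝ v x ^ 2 ∂(stdGaussian E)
      = ‖u‖ ^ 2 * ‖v‖ ^ 2 + 2 * inner ℝ u v ^ 2 := by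
  have he : ∀ x : E, inner ℝ u x ^ 2 * inner ℝ v x ^ 2 = (1 / 12) * (inner ℝ (u + v) x ^ 4
      + inner ℝ (u - v) x ^ 4 - (2 * inner ℝ u x ^ 4 + 2 * inner ℝ v x ^ 4)) := fun x => by
    rw [inner_add_left, inner_sub_left]; ring
  have i1 := integrable_inner_pow (u + v) 4
  have i2 := integrable_inner_pow (u - v) 4
  have i3 := (integrable_inner_pow u 4).const_mul 2
  have i4 := (integrable_inner_pow v 4).const_mul 2
  simp only [he]
  refine ⟨((i1.add i2).sub (i3.add i4)).const_mul _, ?_⟩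
  have hs := integral_sub (i1.add i2) (i3.add i4)
  simp only [Pi.add_apply] at hs
  rw [integral_const_mul, hs, integral_add i1 i2, integral_add i3 i4, integral_const_mul, integral_const_mul]
  simp only [integral_inner_pow_four]
  have h1 := norm_add_sq_real u v
  have h2 := norm_sub_sq_real u v
  rw [show ‖u + v‖ ^ 4 = (‖u + v‖ ^ 2) ^ 2 by ring, show ‖u - v‖ ^ 4 = (‖u - v‖ ^ 2) ^ 2 by ring,
    h1, h2]
  ring

omit [MeasurableSpace E] [BorelSpace E] in
theorem normSqDev_eq_sum (x : E) :
    normSqDev x = ∑ i, (inner ℝ (stdOrthonormalBasis ℝ E i) x ^ 2 - 1) := by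
  rw [normSqDev, ← (stdOrthonormalBasis ℝ E).sum_sq_inner_right]
  simp

/-- Summing the mixed moments over an orthonormal basis leaves only the term 2⟨bᵢ,u⟩², and Parseval
concludes. This 2, together with ‖v‖² ≈ 1, accounts for the 3 in the shift 3/N. -/
theorem integral_normSqDev_mul_inner_sq (u : E) :
    Integrable (fun x => normSqDev x * inner ℝ u x ^ 2) (stdGaussian E) ∧
    ∫ x, normSqDev x * inner ℝ u x ^ 2 ∂(stdGaussian E) = 2 * ‖u‖ ^ 2 := by
  simp only [normSqDev_eq_sum, Finset.sum_mul, sub_mul, one_mul]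
  have hi : ∀ i, Integrable (fun x => inner ℝ (stdOrthonormalBasis ℝ E i) x ^ 2 *
      inner ℝ u x ^ 2 - inner ℝ u x ^ 2) (stdGaussian E) := fun i =>
    (integral_inner_sq_mul_inner_sq _ u).1.sub (integrable_inner_pow u 2)
  refine ⟨integrable_finsetSum _ fun i _ => hi i, ?_⟩
  rw [integral_finsetSum _ fun i _ => hi i]
  have : ∀ i, ∫ x, (inner ℝ (stdOrthonormalBasis ℝ E i) x ^ 2 * inner ℝ u x ^ 2
      - inner ℝ u x ^ 2) ∂(stdGaussian E) = 2 * inner ℝ (stdOrthonormalBasis ℝ E i) u ^ 2 :=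
    fun i => by
    rw [integral_sub (integral_inner_sq_mul_inner_sq _ u).1 (integrable_inner_pow u 2),
      (integral_inner_sq_mul_inner_sq _ u).2, integral_inner_sq]
    simp
  simp only [this]
  rw [← Finset.mul_sum, (stdOrthonormalBasis ℝ E).sum_sq_inner_right]

/-! ### Truncation of the centred squared norm -/

open scoped Classical in
/-- The centred squared norm, replaced by `0` when it exceeds `W` in absolute value. -/
noncomputable def truncDev {E : Type*} [NormedAddCommGroup E] [InnerProductSpace ℝ E]
    (W : ℝ) (x : E) : ℝ :=
  if |normSqDev x| ≤ W then normSqDev x else 0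

section

omit [FiniteDimensional ℝ E] in
@[fun_prop]
theorem measurable_truncDev (W : ℝ) : Measurable (truncDev (E := E) W) := by
  unfold truncDev
  exact Measurable.ite (measurableSet_le (by fun_prop) (by fun_prop)) (by fun_prop) (by fun_prop)

omit [FiniteDimensional ℝ E] [MeasurableSpace E] [BorelSpace E]

theorem truncDev_neg (W : ℝ) (x : E) : truncDev W (-x) = truncDev W x := by
  simp [truncDev, normSqDev_neg]

theorem truncDev_of_le {W : ℝ} {x : E} (h : |normSqDev x| ≤ W) :
    truncDev W x = normSqDev x := if_pos h

theorem abs_truncDev_le {W : ℝ} (hW : 0 ≤ W) (x : E) : |truncDev W x| ≤ W := by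
  unfold truncDev; split_ifs with h
  · exact h
  · simpa using hW

theorem truncDev_sq_le (W : ℝ) (x : E) : truncDev W x ^ 2 ≤ normSqDev x ^ 2 := by
  unfold truncDev; split_ifs with h
  · exact le_rfl
  · simpa using sq_nonneg _

end

theorem integrable_truncDev_mul {W : ℝ} (hW : 0 ≤ W) {g : E → ℝ}
    (hg : Integrable g (stdGaussian E)) :
    Integrable (fun x => truncDev W x * g x) (stdGaussian E) :=
  hg.bdd_mul (c := W) (Measurable.aestronglyMeasurable (by fun_prop))
    (ae_of_all _ fun x => by rw [Real.norm_eq_abs]; exact abs_truncDev_le hW x)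

/-- On the range 16W|t| ≤ 1 truncation turns the exponent of a degree-four product into at most
⟨u,x⟩²/16, which is integrable against the Gaussian. Outside the exponential, the untruncated
squared deviation is kept, so the variance proxy does not see W. -/
theorem hasBernsteinMGF_truncDev_mul_inner_sq {n : ℕ} (hn : 1 ≤ n) (hE : Module.finrank ℝ E ≤ n)
    {u : E} (hu : ‖u‖ = 1) {W : ℝ} (hW : 0 ≤ W) :
    HasBernsteinMGF (stdGaussian E) (fun x => truncDev W x * inner ℝ u x ^ 2
      - ∫ y, truncDev W y * inner ℝ u y ^ 2 ∂(stdGaussian E)) (2 * 10 ^ 5 * n) (16 * W) := by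
  have hd := integral_expDominator hn hE hu
  refine HasBernsteinMGF.sub_integral (by fun_prop)
    (integrable_truncDev_mul hW (integrable_inner_pow u 2)) hd.1 hd.2 fun t x ht => ?_
  have h1 : |t * (truncDev W x * inner ℝ u x ^ 2)| ≤ inner ℝ u x ^ 2 / 16 := by
    rw [abs_mul, abs_mul, abs_of_nonneg (sq_nonneg (inner ℝ u x))]
    calc _ ≤ |t| * (W * inner ℝ u x ^ 2) := by gcongr; exact abs_truncDev_le hW x
      _ = (|t| * (16 * W)) * (inner ℝ u x ^ 2 / 16) := by ring
      _ ≤ 1 * (inner ℝ u x ^ 2 / 16) := by gcongr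
      _ = _ := one_mul _
  rw [mul_pow, mul_assoc, expDominator]
  refine mul_le_mul (truncDev_sq_le W x) ?_ (by positivity) (by positivity)
  gcongr
  linarith [show (inner ℝ u x ^ 2) ^ 2 = inner ℝ u x ^ 4 by ring]

theorem integral_truncDev_mul_inner {W : ℝ} (u : E) :
    ∫ y, truncDev W y * inner ℝ u y ∂(stdGaussian E) = 0 := by
  have h : ∫ y, truncDev W y * inner ℝ u y ∂(stdGaussian E)
      = ∫ y, -(truncDev W y * inner ℝ u y) ∂(stdGaussian E) := by
    conv_lhs => rw [← stdGaussian_map_neg]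
    rw [integral_map (by fun_prop) (Measurable.aestronglyMeasurable (by fun_prop))]
    simp [truncDev_neg]
  rw [integral_neg] at h
  linarith

theorem hasBernsteinMGF_truncDev_mul_inner {n : ℕ} (hn : 1 ≤ n) (hE : Module.finrank ℝ E ≤ n)
    {u : E} (hu : ‖u‖ = 1) {W : ℝ} (hW : 0 ≤ W) :
    HasBernsteinMGF (stdGaussian E) (fun x => truncDev W x * inner ℝ u x)
      (2 * 10 ^ 5 * n) (16 * W) := by
  have hd := integral_expDominator hn hE hu
  have hi : Integrable (fun x => inner ℝ u x) (stdGaussian E) := by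
    simpa using integrable_inner_pow u 1
  have key := HasBernsteinMGF.sub_integral (μ := stdGaussian E) (b := 16 * W)
    (f := fun x => truncDev W x * inner ℝ u x) (by fun_prop)
    (integrable_truncDev_mul hW hi) hd.1 hd.2 fun t x ht => ?_
  · simpa [integral_truncDev_mul_inner] using key
  set X : ℝ := inner ℝ u x with hX
  have h1 : |t * (truncDev W x * X)| ≤ 1 / 32 + X ^ 2 / 16 := by
    rw [abs_mul, abs_mul]
    calc _ ≤ |t| * (W * |X|) := by gcongr; exact abs_truncDev_le hW x
      _ = (|t| * (16 * W)) * (|X| / 16) := by ring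
      _ ≤ 1 * (|X| / 16) := by gcongr
      _ ≤ _ := by nlinarith [sq_nonneg (|X| - 1), sq_abs X]
  have h2 : X ^ 2 * (3 / 2) ≤ 1 + X ^ 4 := by nlinarith [sq_nonneg (X ^ 2 - 1)]
  rw [mul_pow, mul_assoc, expDominator]
  refine mul_le_mul (truncDev_sq_le W x) ?_ (by positivity) (by positivity)
  · calc X ^ 2 * Real.exp |t * (truncDev W x * X)|
        ≤ X ^ 2 * Real.exp (1 / 32 + X ^ 2 / 16) := by gcongr
      _ = X ^ 2 * Real.exp (1 / 32) * Real.exp (X ^ 2 / 16) := by rw [Real.exp_add]; ring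
      _ ≤ X ^ 2 * (3 / 2) * Real.exp (X ^ 2 / 16) := by
        gcongr; exact exp_le_three_halves (by norm_num)
      _ ≤ _ := by gcongr

/-- The product is odd, so its moment generating function is the mean of a hyperbolic cosine, which
increases when the truncated factor is replaced by its bound W. There is no constraint on t, hence
no linear term in the tail threshold. -/
theorem hasBernsteinMGF_truncDev_mul_inner_subgaussian {u : E} (hu : ‖u‖ = 1) {W : ℝ}
    (hW : 0 ≤ W) :
    HasBernsteinMGF (stdGaussian E) (fun x => truncDev W x * inner ℝ u x) (W ^ 2 / 2) 0 :=
  fun t _ => by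
  have hg := hasBernsteinMGF_inner u (t * W) (by simp)
  have hg' := hasBernsteinMGF_inner u (-(t * W)) (by simp)
  have hpt : ∀ x : E, Real.exp (t * (truncDev W x * inner ℝ u x))
      + Real.exp (-(t * (truncDev W x * inner ℝ u x)))
      ≤ Real.exp (t * W * inner ℝ u x) + Real.exp (-(t * W) * inner ℝ u x) := fun x => by
    have h1 : |t * (truncDev W x * inner ℝ u x)| ≤ |t * W * inner ℝ u x| := by
      rw [mul_assoc, abs_mul, abs_mul, abs_mul, abs_mul, abs_of_nonneg hW]
      gcongr; exact abs_truncDev_le hW x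
    have h2 := Real.cosh_le_cosh.2 h1
    rw [Real.cosh_eq, Real.cosh_eq] at h2
    rw [neg_mul]; linarith
  have hi1 := hg.1.add hg'.1
  have hi : ∀ s : ℝ, (s = 1 ∨ s = -1) → Integrable
      (fun x : E => Real.exp (s * (t * (truncDev W x * inner ℝ u x)))) (stdGaussian E) :=
    fun s hs => by
    refine hi1.mono' (Measurable.aestronglyMeasurable (by fun_prop)) (ae_of_all _ fun x => ?_)
    rw [Real.norm_eq_abs, Real.abs_exp]
    refine le_trans ?_ (hpt x)
    rcases hs with rfl | rfl <;> simp [Real.exp_nonneg]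
  have hp := hi 1 (Or.inl rfl)
  have hm := hi (-1) (Or.inr rfl)
  simp only [one_mul, neg_one_mul] at hp hm
  refine ⟨hp, ?_⟩
  have heq : ∫ x : E, Real.exp (-(t * (truncDev W x * inner ℝ u x))) ∂(stdGaussian E)
      = ∫ x : E, Real.exp (t * (truncDev W x * inner ℝ u x)) ∂(stdGaussian E) := by
    conv_lhs => rw [← stdGaussian_map_neg]
    rw [integral_map (by fun_prop) (Measurable.aestronglyMeasurable (by fun_prop))]
    simp [truncDev_neg]
  have hle := integral_mono (hp.add hm) hi1 hpt
  simp only [Pi.add_apply] at hle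
  rw [integral_add hp hm, integral_add hg.1 hg'.1, heq] at hle
  have e1 := hg.2
  have e2 := hg'.2
  rw [hu, neg_sq] at e2
  rw [hu] at e1
  rw [show t ^ 2 * (W ^ 2 / 2) = (t * W) ^ 2 * (1 ^ 2 / 2) by ring]
  linarith

theorem abs_integral_truncDev_sub_two_le {n : ℕ} (hn : 1 ≤ n) (hE : Module.finrank ℝ E ≤ n)
    {u : E} (hu : ‖u‖ = 1) {W : ℝ} (hW : 0 ≤ W) {r : ℝ} (hr : 0 < r) :
    |∫ x, truncDev W x * inner ℝ u x ^ 2 ∂(stdGaussian E) - 2| ≤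
      r * (stdGaussian E).real {x | W ≤ |normSqDev x|} + 2 * 10 ^ 5 * n / r := by
  have hd := integral_expDominator hn hE hu
  have h2 := integral_normSqDev_mul_inner_sq u
  rw [hu] at h2
  have hms : MeasurableSet {x : E | W ≤ |normSqDev x|} :=
    measurableSet_le (by fun_prop) (by fun_prop)
  have hti := integrable_truncDev_mul hW (integrable_inner_pow u 2)
  have hsub := integral_sub hti h2.1
  rw [h2.2, one_pow, mul_one] at hsub
  rw [← hsub]
  set S := {x : E | W ≤ |normSqDev x|}
  have hpt : ∀ x : E, |truncDev W x * inner ℝ u x ^ 2 - normSqDev x * inner ℝ u x ^ 2|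
      ≤ r * S.indicator (fun _ => (1 : ℝ)) x + expDominator u x / r := fun x => by
    have hnn : 0 ≤ expDominator u x := by unfold expDominator; positivity
    by_cases hx : |normSqDev x| ≤ W
    · rw [truncDev_of_le hx, sub_self, abs_zero]
      have : 0 ≤ S.indicator (fun _ => (1 : ℝ)) x := Set.indicator_nonneg (by simp) x
      positivity
    · have hxS : x ∈ S := (not_le.1 hx).le
      rw [Set.indicator_of_mem hxS, truncDev, if_neg hx, zero_mul, zero_sub, abs_neg, mul_one]
      set z := normSqDev x * inner ℝ u x ^ 2 with hz
      have h3 : z ^ 2 ≤ expDominator u x := by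
        rw [hz, mul_pow, expDominator]
        gcongr
        calc (inner ℝ u x ^ 2) ^ 2 ≤ (1 + inner ℝ u x ^ 4) * 1 := by
              linarith [show (inner ℝ u x ^ 2) ^ 2 = inner ℝ u x ^ 4 by ring]
          _ ≤ _ := by gcongr; exact Real.one_le_exp (by positivity)
      -- Trades the tail expectation of |z| for a tail probability and a second moment; the free
      -- parameter r balances them.
      have h4 : |z| ≤ r + z ^ 2 / r := by
        rw [← sub_nonneg]
        have : r + z ^ 2 / r - |z| = ((r - |z| / 2) ^ 2 + 3 / 4 * |z| ^ 2) / r := by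
          rw [sq_abs]; field_simp; nlinarith [sq_abs z]
        rw [this]; positivity
      refine h4.trans ?_
      gcongr
  refine (abs_integral_le_integral_abs).trans ?_
  have hind : Integrable (S.indicator (fun _ => (1 : ℝ))) (stdGaussian E) :=
    (integrable_const 1).indicator hms
  refine (integral_mono (hti.sub h2.1).abs ((hind.const_mul r).add (hd.1.div_const r)) hpt).trans ?_
  simp only [Pi.add_apply]
  rw [integral_add (hind.const_mul r) (hd.1.div_const r), integral_const_mul, integral_div,
    integral_indicator_const _ hms]
  simp only [smul_eq_mul, mul_one]
  gcongr
  exact hd.2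


/-! ### Nets of the unit sphere -/

section Net

variable {E : Type*} [NormedAddCommGroup E] [InnerProductSpace ℝ E] [FiniteDimensional ℝ E]

variable (E) in
-- A 1/2-separated subset of the sphere of maximal cardinality is a 1/2-net. Doubled, it is
-- 1-separated in the ball of radius 2, where the volume bound 5^dim applies.
theorem exists_sphere_net :
    ∃ T : Finset E, T.card ≤ 5 ^ Module.finrank ℝ E ∧ (∀ u ∈ T, ‖u‖ = 1) ∧
      ∀ x : E, ‖x‖ = 1 → ∃ u ∈ T, ‖x - u‖ ≤ 1 / 2 := by
  classical
  let S : Set (Finset E) :=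
    {T | (∀ u ∈ T, ‖u‖ = 1) ∧ ∀ c ∈ T, ∀ d ∈ T, c ≠ d → 1 / 2 ≤ ‖c - d‖}
  have hcard : ∀ T ∈ S, T.card ≤ 5 ^ Module.finrank ℝ E := fun T hT => by
    have hinj : Function.Injective (fun x : E => (2 : ℝ) • x) :=
      smul_right_injective E two_ne_zero
    rw [← Finset.card_image_of_injective T hinj]
    apply Besicovitch.card_le_of_separated
    · intro c hc
      obtain ⟨u, hu, rfl⟩ := Finset.mem_image.1 hc
      simp [norm_smul, hT.1 u hu]
    · intro c hc d hd hcd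
      obtain ⟨u, hu, rfl⟩ := Finset.mem_image.1 hc
      obtain ⟨w, hw, rfl⟩ := Finset.mem_image.1 hd
      rw [← smul_sub, norm_smul]
      have := hT.2 u hu w hw fun h => hcd (by rw [h])
      norm_num
      linarith
  -- Cardinalities are bounded, so minimizing the deficit 5^dim - card yields a separated set of
  -- maximal cardinality.
  obtain ⟨T, hT, hmax⟩ := (measure fun T : Finset E => 5 ^ Module.finrank ℝ E - T.card).wf.has_min S
    ⟨∅, by simp [S]⟩
  refine ⟨T, hcard T hT, hT.1, fun x hx => ?_⟩
  by_contra! hfar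
  have hxT : x ∉ T := fun h => by
    have := hfar x h; norm_num at this
  have hins : insert x T ∈ S := by
    refine ⟨fun u hu => ?_, fun c hc d hd hcd => ?_⟩
    · rcases Finset.mem_insert.1 hu with rfl | hu
      exacts [hx, hT.1 u hu]
    · rcases Finset.mem_insert.1 hc with rfl | hc' <;> rcases Finset.mem_insert.1 hd with rfl | hd'
      · exact absurd rfl hcd
      · exact (hfar d hd').le
      · rw [norm_sub_rev]; exact (hfar c hc').le
      · exact hT.2 c hc' d hd' hcd
  apply hmax _ hins
  have h1 := hcard _ hins
  rw [Finset.card_insert_of_notMem hxT] at h1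
  change _ - (insert x T).card < _ - T.card
  rw [Finset.card_insert_of_notMem hxT]
  omega

variable {T : Finset E} (hT1 : ∀ u ∈ T, ‖u‖ = 1)
  (hT : ∀ x : E, ‖x‖ = 1 → ∃ u ∈ T, ‖x - u‖ ≤ 1 / 2)

include hT in
omit [FiniteDimensional ℝ E] in
theorem abs_inner_le_of_net {z : E} {t : ℝ} (ht : 0 ≤ t) (h : ∀ u ∈ T, |inner ℝ u z| ≤ t) (x : E) :
    |inner ℝ x z| ≤ 2 * t * ‖x‖ := by
  have hz : ‖z‖ ≤ 2 * t := by
    rcases eq_or_ne z 0 with rfl | hz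
    · simpa using ht
    have hz0 : 0 < ‖z‖ := norm_pos_iff.2 hz
    obtain ⟨u, hu, hxu⟩ := hT (‖z‖⁻¹ • z) (by rw [norm_smul]; simp [hz0.ne'])
    -- Testing z against its own direction gives ‖z‖ ≤ t + ‖z‖/2.
    have h1 : ‖z‖ = inner ℝ u z + inner ℝ (‖z‖⁻¹ • z - u) z := by
      rw [← inner_add_left, add_sub_cancel, real_inner_smul_left, real_inner_self_eq_norm_sq]
      field_simp
    have h2 := (le_abs_self _).trans (h u hu)
    have h3 := (le_abs_self _).trans (abs_real_inner_le_norm (‖z‖⁻¹ • z - u) z)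
    nlinarith
  calc |inner ℝ x z| ≤ ‖x‖ * ‖z‖ := abs_real_inner_le_norm x z
    _ ≤ ‖x‖ * (2 * t) := by gcongr
    _ = _ := by ring

include hT1 hT in
-- Let M be the maximum of |B x x| on the sphere; polarization extends it to |B x y| ≤ M‖x‖‖y‖.
-- Bounding B x x - B u u by 2M‖x - u‖ would gain nothing for a 1/2-net. Factoring it as B (x-u)
-- (x+u) does: by the parallelogram law ‖x-u‖‖x+u‖ ≤ √(15/16) ≤ 31/32, so M ≤ t + 31M/32.
theorem abs_bilin_le_of_net {B : LinearMap.BilinForm ℝ E} (hB : ∀ x y, B x y = B y x) {t : ℝ}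
    (h : ∀ u ∈ T, |B u u| ≤ t) (x y : E) : |B x y| ≤ 32 * t * ‖x‖ * ‖y‖ := by
  rcases eq_or_ne x 0 with rfl | hx
  · simp
  have hcont : Continuous fun x => |B x x| := by
    have h1 : Continuous fun x => (LinearMap.toContinuousLinearMap (B x)) :=
      (LinearMap.toContinuousLinearMap.toLinearMap ∘ₗ B).continuous_of_finiteDimensional
    exact (h1.clm_apply continuous_id).abs
  have hx' : 0 < ‖x‖ := norm_pos_iff.2 hx
  have hne : (Metric.sphere (0 : E) 1).Nonempty :=
    ⟨‖x‖⁻¹ • x, by simp [norm_smul, hx'.ne']⟩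
  obtain ⟨x₀, hx₀, hmax⟩ := (isCompact_sphere (0 : E) 1).exists_isMaxOn hne hcont.continuousOn
  set M := |B x₀ x₀| with hM
  have hx₀1 : ‖x₀‖ = 1 := by simpa using hx₀
  have hquad : ∀ z : E, |B z z| ≤ M * ‖z‖ ^ 2 := fun z => by
    rcases eq_or_ne z 0 with rfl | hz
    · simp
    have hz0 : 0 < ‖z‖ := norm_pos_iff.2 hz
    have h1 : |B (‖z‖⁻¹ • z) (‖z‖⁻¹ • z)| ≤ M :=
      hmax (show ‖z‖⁻¹ • z ∈ Metric.sphere (0 : E) 1 by simp [norm_smul, hz0.ne'])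
    simp only [map_smul, LinearMap.smul_apply, smul_eq_mul, abs_mul, abs_inv, abs_norm] at h1
    rw [← mul_assoc, ← mul_inv, inv_mul_eq_div, div_le_iff₀ (by positivity)] at h1
    rw [sq]; exact h1
  have hunit : ∀ a b : E, ‖a‖ = 1 → ‖b‖ = 1 → |B a b| ≤ M := fun a b ha hb => by
    have h1 := hquad (a + b)
    have h2 := hquad (a - b)
    have h3 := parallelogram_law_with_norm ℝ a b
    have h4 : 4 * B a b = B (a + b) (a + b) - B (a - b) (a - b) := by
      simp only [map_add, map_sub, LinearMap.add_apply, LinearMap.sub_apply, hB b a]; ring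
    rw [ha, hb] at h3
    have h5 : |4 * B a b| ≤ 4 * M := by
      rw [h4]
      refine (abs_sub _ _).trans ((add_le_add h1 h2).trans (le_of_eq ?_))
      rw [← mul_add, h3]; ring
    rw [abs_mul, abs_of_pos (by norm_num : (0 : ℝ) < 4)] at h5
    linarith
  have hbil : ∀ a b : E, |B a b| ≤ M * ‖a‖ * ‖b‖ := fun a b => by
    rcases eq_or_ne a 0 with rfl | ha
    · simp
    rcases eq_or_ne b 0 with rfl | hb
    · simp
    have ha0 : 0 < ‖a‖ := norm_pos_iff.2 ha
    have hb0 : 0 < ‖b‖ := norm_pos_iff.2 hb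
    have h1 := hunit (‖a‖⁻¹ • a) (‖b‖⁻¹ • b) (by simp [norm_smul, ha0.ne'])
      (by simp [norm_smul, hb0.ne'])
    simp only [map_smul, LinearMap.smul_apply, smul_eq_mul, abs_mul, abs_inv, abs_norm] at h1
    rw [← mul_assoc, ← mul_inv, inv_mul_eq_div, div_le_iff₀ (by positivity)] at h1
    linarith
  have hM0 : 0 ≤ M := abs_nonneg _
  have hMt : M ≤ 32 * t := by
    obtain ⟨u, hu, hxu⟩ := hT x₀ hx₀1
    have h1 : B x₀ x₀ = B u u + B (x₀ - u) (x₀ + u) := by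
      simp only [map_add, map_sub, LinearMap.sub_apply, hB x₀ u]; ring
    have h2 := hbil (x₀ - u) (x₀ + u)
    have h3 := parallelogram_law_with_norm ℝ x₀ u
    rw [hx₀1, hT1 u hu] at h3
    have h4 : ‖x₀ - u‖ * ‖x₀ + u‖ ≤ 31 / 32 := by
      apply abs_le_of_sq_le_sq' _ (by norm_num) |>.2
      rw [mul_pow, sq ‖x₀ + u‖]
      have h5 : ‖x₀ + u‖ * ‖x₀ + u‖ = 4 - ‖x₀ - u‖ ^ 2 := by linarith
      have h6 : ‖x₀ - u‖ ^ 2 ≤ 1 / 4 := by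
        have := norm_nonneg (x₀ - u); nlinarith
      rw [h5]
      nlinarith [sq_nonneg (‖x₀ - u‖)]
    have h7 : M ≤ |B u u| + |B (x₀ - u) (x₀ + u)| := by rw [hM, h1]; exact abs_add_le _ _
    have h8 := h u hu
    nlinarith
  calc |B x y| ≤ M * ‖x‖ * ‖y‖ := hbil x y
    _ ≤ _ := by gcongr

end Net

/-- The net has at most 5^m ≤ e^(2m) points, and the summand 2m in s pays for the union bound. -/
theorem measureReal_exists_mem_le {Ω E : Type*} [MeasurableSpace Ω] (μ : Measure Ω)
    [IsProbabilityMeasure μ] {T : Finset E} {m : ℕ} (hT : T.card ≤ 5 ^ m) {F : E → Ω → ℝ}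
    {t L s : ℝ} (hs : 2 * m + 3 * L ≤ s)
    (h : ∀ u ∈ T, μ.real {y | t ≤ |F u y|} ≤ 2 * Real.exp (-s)) :
    μ.real {y | ∃ u ∈ T, t ≤ |F u y|} ≤ 2 * Real.exp (-(3 * L)) := by
  have h5 : (5 : ℝ) ≤ Real.exp 2 := by
    have := Real.quadratic_le_exp_of_nonneg (x := 2) (by norm_num)
    norm_num at this ⊢; exact this
  have h1 : {y | ∃ u ∈ T, t ≤ |F u y|} = ⋃ u ∈ T, {y | t ≤ |F u y|} := by ext; simp
  rw [h1]
  calc _ ≤ ∑ u ∈ T, μ.real {y | t ≤ |F u y|} := measureReal_biUnion_finset_le _ _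
    _ ≤ ∑ u ∈ T, 2 * Real.exp (-s) := Finset.sum_le_sum h
    _ = T.card * (2 * Real.exp (-s)) := by rw [Finset.sum_const, nsmul_eq_mul]
    _ ≤ Real.exp 2 ^ m * (2 * Real.exp (-(2 * m + 3 * L))) := by
      gcongr
      calc (T.card : ℝ) ≤ 5 ^ m := by exact_mod_cast hT
        _ ≤ _ := by gcongr
    _ = _ := by
      rw [← Real.exp_nat_mul, mul_left_comm, ← Real.exp_add]; ring_nf


/-! ### Concentration of the row sums -/

section Concentration

variable {E : Type*} [NormedAddCommGroup E] [InnerProductSpace ℝ E] [FiniteDimensional ℝ E]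
  [MeasurableSpace E] [BorelSpace E] {ι : Type*} [Fintype ι]

theorem HasBernsteinMGF.weighted_sum {E : Type*} [MeasurableSpace E] {μ : Measure E}
    [IsProbabilityMeasure μ] {f : E → ℝ} {a b : ℝ} (hf : HasBernsteinMGF μ f a b) (ha : 0 ≤ a)
    (hb : 0 ≤ b) {c : ι → ℝ} {C κ : ℝ} (hC : ∑ i, c i ^ 2 ≤ C) (hκ : ∀ i, |c i| ≤ κ) :
    HasBernsteinMGF (Measure.pi fun _ : ι => μ) (fun h => ∑ i, c i * f (h i)) (C * a) (κ * b) := by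
  have h1 := HasBernsteinMGF.sum_pi (f := fun i x => c i * f x) (a := fun i => c i ^ 2 * a)
    (b := κ * b) fun i => (hf.const_mul (c i)).mono le_rfl (by gcongr; exact hκ i)
  refine h1.mono ?_ le_rfl
  rw [← Finset.sum_mul]
  gcongr

theorem measureReal_net_weighted_sum_le {T : Finset E} {m : ℕ} (hT : T.card ≤ 5 ^ m)
    (hT1 : ∀ u ∈ T, ‖u‖ = 1) {f : E → E → ℝ} {a b : ℝ}
    (hf : ∀ u : E, ‖u‖ = 1 → HasBernsteinMGF (stdGaussian E) (f u) a b) (ha : 0 ≤ a) (hb : 0 ≤ b)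
    {c : ι → ℝ} {C κ : ℝ} (hC : ∑ i, c i ^ 2 ≤ C) (hκ0 : 0 ≤ κ) (hκ : ∀ i, |c i| ≤ κ)
    {s L t : ℝ} (hs : 2 * m + 3 * L ≤ s) (hs0 : 0 < s) (ht : 0 < t)
    (hst : 2 * √(C * a * s) + κ * b * s ≤ t) :
    (Measure.pi fun _ : ι => stdGaussian E).real
      {h | ∃ u ∈ T, t ≤ |∑ i, c i * f u (h i)|} ≤ 2 * Real.exp (-(3 * L)) := by
  refine measureReal_exists_mem_le _ hT hs fun u hu => ?_
  have hC0 : 0 ≤ C := (Finset.sum_nonneg fun i _ => sq_nonneg (c i)).trans hC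
  exact ((hf u (hT1 u hu)).weighted_sum ha hb hC hκ).measureReal_abs_ge_le (by positivity)
    (by positivity) hs0 ht hst

theorem measureReal_normSqDev_ge_le {n : ℕ} (hE : Module.finrank ℝ E ≤ n) {L W : ℝ} (hL : 0 < L)
    (hW : 2 * √(2 * n * (3 * L)) + 12 * L ≤ W) :
    (stdGaussian E).real {x | W ≤ |normSqDev x|} ≤ 2 * Real.exp (-(3 * L)) := by
  have hE' : (Module.finrank ℝ E : ℝ) ≤ n := by exact_mod_cast hE
  have h := (hasBernsteinMGF_normSqDev (E := E)).mono (a' := 2 * n) (by linarith) le_rfl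
  refine h.measureReal_abs_ge_le (by positivity) (by norm_num) (by positivity) ?_ (by linarith)
  have := Real.sqrt_nonneg (2 * n * (3 * L))
  linarith

theorem measureReal_exists_normSqDev_ge_le {n : ℕ} (hE : Module.finrank ℝ E ≤ n) {L W : ℝ}
    (hL : 0 < L) (hW : 2 * √(2 * n * (3 * L)) + 12 * L ≤ W) :
    (Measure.pi fun _ : ι => stdGaussian E).real {h | ∃ i, W ≤ |normSqDev (h i)|}
      ≤ Fintype.card ι * (2 * Real.exp (-(3 * L))) := by
  have h1 : {h : ι → E | ∃ i, W ≤ |normSqDev (h i)|}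
      = ⋃ i ∈ Finset.univ, {h | W ≤ |normSqDev (h i)|} := by ext; simp
  rw [h1]
  refine (measureReal_biUnion_finset_le _ _).trans ?_
  have h2 : ∀ i : ι, (Measure.pi fun _ : ι => stdGaussian E).real {h | W ≤ |normSqDev (h i)|}
      ≤ 2 * Real.exp (-(3 * L)) := fun i => by
    have hms : MeasurableSet {x : E | W ≤ |normSqDev x|} :=
      measurableSet_le (by fun_prop) (by fun_prop)
    have := (measurePreserving_eval (fun _ : ι => stdGaussian E) i).measureReal_preimage
      hms.nullMeasurableSet
    exact this.trans_le (measureReal_normSqDev_ge_le hE hL hW)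
  refine (Finset.sum_le_sum fun i _ => h2 i).trans_eq ?_
  rw [Finset.sum_const, nsmul_eq_mul, Finset.card_univ]

end Concentration

/-! ### The scales of the problem -/

/-- The square roots `a`, `l`, `y` of `n`, `log (N / δ)` and `N`, the norms of the planted vector
(`r = ‖v‖`, `σ₄ = ‖v‖₄²`, `σ₆ = ‖v‖₆³`, `κ = ‖v‖_∞`), and the resulting error bound `η`. -/
structure Scales where
  (a l y r σ₄ σ₆ κ q η : ℝ)
  one_le_a : 1 ≤ a
  a_le_y : a ≤ y
  one_le_l : 1 ≤ l
  l_pow_le : l ^ 7 ≤ y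
  r_nonneg : 0 ≤ r
  σ₄_nonneg : 0 ≤ σ₄
  σ₆_nonneg : 0 ≤ σ₆
  κ_nonneg : 0 ≤ κ
  q_nonneg : 0 ≤ q
  η_eq : η = (r + 1) * (a ^ 2 * l / y ^ 3) + σ₄ * (a * l / y ^ 2) + σ₆ * ((a + l) / y)
    + κ ^ 2 * ((a ^ 2 * l ^ 2 + l ^ 4) / y ^ 2) + (a * l) ^ 3 / y ^ 4 + q / y ^ 2

namespace Scales

variable (S : Scales)

/-- The truncation level of the centred squared row norms. -/
def W : ℝ := 5 * (S.a * S.l) + 12 * S.l ^ 2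

theorem one_le_y : 1 ≤ S.y := S.one_le_a.trans S.a_le_y

theorem l_pow_le_of_le {k : ℕ} (hk : k ≤ 7) : S.l ^ k ≤ S.y :=
  (pow_le_pow_right₀ S.one_le_l hk).trans S.l_pow_le

theorem W_nonneg : 0 ≤ S.W := by
  have := S.one_le_a; have := S.one_le_l
  unfold W; positivity

theorem W_le_of_le (h : S.l ≤ S.a) : S.W ≤ 17 * (S.a * S.l) := by
  have := S.one_le_l
  unfold W; nlinarith

theorem W_le_of_ge (h : S.a ≤ S.l) : S.W ≤ 17 * S.l ^ 2 := by
  have := S.one_le_l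
  unfold W; nlinarith

theorem sq_add_sq_le : S.a ^ 2 + S.l ^ 2 ≤ 2 * (S.a * S.l) ^ 2 := by
  have h1 : 1 ≤ S.a ^ 2 := one_le_pow₀ S.one_le_a
  have h2 : 1 ≤ S.l ^ 2 := one_le_pow₀ S.one_le_l
  rw [mul_pow]; nlinarith

/-- Here and in the next three lemmas, the nonnegative summands of η that are not needed are dropped
and the denominators cleared. -/
theorem η_mul_y : S.σ₆ * (S.a + S.l) ≤ S.y * S.η := by
  have h1 := S.one_le_y; have := S.one_le_a; have := S.one_le_l; have := S.r_nonneg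
  have := S.σ₄_nonneg; have := S.σ₆_nonneg; have := S.κ_nonneg; have := S.q_nonneg
  have h : S.σ₆ * ((S.a + S.l) / S.y) ≤ S.η := by
    have : 0 ≤ (S.r + 1) * (S.a ^ 2 * S.l / S.y ^ 3) + S.σ₄ * (S.a * S.l / S.y ^ 2)
      + S.κ ^ 2 * ((S.a ^ 2 * S.l ^ 2 + S.l ^ 4) / S.y ^ 2) + (S.a * S.l) ^ 3 / S.y ^ 4
      + S.q / S.y ^ 2 := by positivity
    rw [S.η_eq]; linarith
  calc _ = S.y * (S.σ₆ * ((S.a + S.l) / S.y)) := by field_simp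
    _ ≤ _ := by gcongr

theorem η_mul_y_sq : S.σ₄ * (S.a * S.l) + S.κ ^ 2 * (S.a ^ 2 * S.l ^ 2 + S.l ^ 4) + S.q
    ≤ S.y ^ 2 * S.η := by
  have h1 := S.one_le_y; have := S.one_le_a; have := S.one_le_l; have := S.r_nonneg
  have := S.σ₄_nonneg; have := S.σ₆_nonneg; have := S.κ_nonneg; have := S.q_nonneg
  have h : S.σ₄ * (S.a * S.l / S.y ^ 2) + S.κ ^ 2 * ((S.a ^ 2 * S.l ^ 2 + S.l ^ 4) / S.y ^ 2)
      + S.q / S.y ^ 2 ≤ S.η := by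
    have : 0 ≤ (S.r + 1) * (S.a ^ 2 * S.l / S.y ^ 3) + S.σ₆ * ((S.a + S.l) / S.y)
      + (S.a * S.l) ^ 3 / S.y ^ 4 := by positivity
    rw [S.η_eq]; linarith
  calc _ = S.y ^ 2 * (S.σ₄ * (S.a * S.l / S.y ^ 2)
        + S.κ ^ 2 * ((S.a ^ 2 * S.l ^ 2 + S.l ^ 4) / S.y ^ 2) + S.q / S.y ^ 2) := by field_simp
    _ ≤ _ := by gcongr

theorem η_mul_y_cube : (S.r + 1) * (S.a ^ 2 * S.l)
    + S.κ ^ 2 * (S.a ^ 2 * S.l ^ 2 + S.l ^ 4) * S.y ≤ S.y ^ 3 * S.η := by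
  have h1 := S.one_le_y; have := S.one_le_a; have := S.one_le_l; have := S.r_nonneg
  have := S.σ₄_nonneg; have := S.σ₆_nonneg; have := S.κ_nonneg; have := S.q_nonneg
  have h : (S.r + 1) * (S.a ^ 2 * S.l / S.y ^ 3)
      + S.κ ^ 2 * ((S.a ^ 2 * S.l ^ 2 + S.l ^ 4) / S.y ^ 2) ≤ S.η := by
    have : 0 ≤ S.σ₄ * (S.a * S.l / S.y ^ 2) + S.σ₆ * ((S.a + S.l) / S.y)
      + (S.a * S.l) ^ 3 / S.y ^ 4 + S.q / S.y ^ 2 := by positivity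
    rw [S.η_eq]; linarith
  calc _ = S.y ^ 3 * ((S.r + 1) * (S.a ^ 2 * S.l / S.y ^ 3)
      + S.κ ^ 2 * ((S.a ^ 2 * S.l ^ 2 + S.l ^ 4) / S.y ^ 2)) := by field_simp
    _ ≤ _ := by gcongr

theorem η_mul_y_pow_four : S.a ^ 2 * S.l * S.y + (S.a * S.l) ^ 3 ≤ S.y ^ 4 * S.η := by
  have h1 := S.one_le_y; have := S.one_le_a; have := S.one_le_l; have := S.r_nonneg
  have := S.σ₄_nonneg; have := S.σ₆_nonneg; have := S.κ_nonneg; have := S.q_nonneg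
  have h : 1 * (S.a ^ 2 * S.l / S.y ^ 3) + (S.a * S.l) ^ 3 / S.y ^ 4 ≤ S.η := by
    have h2 : 0 ≤ S.r * (S.a ^ 2 * S.l / S.y ^ 3) + S.σ₄ * (S.a * S.l / S.y ^ 2)
      + S.σ₆ * ((S.a + S.l) / S.y)
      + S.κ ^ 2 * ((S.a ^ 2 * S.l ^ 2 + S.l ^ 4) / S.y ^ 2) + S.q / S.y ^ 2 := by positivity
    rw [S.η_eq]; linarith
  calc _ = S.y ^ 4 * (1 * (S.a ^ 2 * S.l / S.y ^ 3) + (S.a * S.l) ^ 3 / S.y ^ 4) := by field_simp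
    _ ≤ _ := by gcongr

theorem η_pos : 0 < S.η := by
  have h1 := S.one_le_y; have := S.one_le_a; have := S.one_le_l
  have h2 := S.η_mul_y_pow_four
  have h3 : 0 < S.y ^ 4 * S.η := lt_of_lt_of_le (by positivity) h2
  exact pos_of_mul_pos_right h3 (by positivity)

/-! The numerical inequalities that turn the Bernstein thresholds into multiples of `η`. -/

theorem threshold_normSqDev :
    2 * √(S.σ₄ ^ 2 * (2 * S.a ^ 2) * (3 * S.l ^ 2)) + S.κ ^ 2 * 4 * (3 * S.l ^ 2)
      ≤ 12 * (S.y ^ 2 * S.η) := by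
  have h0 := S.η_mul_y_sq
  have := S.one_le_a; have := S.one_le_l; have := S.σ₄_nonneg; have := S.q_nonneg
  have h1 : √(S.σ₄ ^ 2 * (2 * S.a ^ 2) * (3 * S.l ^ 2)) ≤ 3 * (S.σ₄ * (S.a * S.l)) := by
    apply Real.sqrt_le_iff.2 ⟨by positivity, _⟩
    have : 0 ≤ (S.σ₄ * (S.a * S.l)) ^ 2 := sq_nonneg _
    nlinarith
  have h2 : S.κ ^ 2 * S.l ^ 2 ≤ S.κ ^ 2 * (S.a ^ 2 * S.l ^ 2 + S.l ^ 4) := by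
    gcongr
    have : 1 ≤ S.a ^ 2 := one_le_pow₀ S.one_le_a
    have : 0 ≤ S.l ^ 4 := by positivity
    nlinarith [sq_nonneg S.l]
  have : 0 ≤ S.σ₄ * (S.a * S.l) := by positivity
  linarith

theorem threshold_cube_inner :
    2 * √(S.σ₆ ^ 2 * (1 / 2) * (3 * (S.a ^ 2 + S.l ^ 2))) ≤ 4 * (S.y * S.η) := by
  have h0 := S.η_mul_y
  have := S.one_le_a; have := S.one_le_l; have := S.σ₆_nonneg
  have h1 : √(S.σ₆ ^ 2 * (1 / 2) * (3 * (S.a ^ 2 + S.l ^ 2))) ≤ 2 * (S.σ₆ * (S.a + S.l)) := by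
    apply Real.sqrt_le_iff.2 ⟨by positivity, _⟩
    have : 0 ≤ S.σ₆ ^ 2 * (S.a * S.l) := by positivity
    have : 0 ≤ S.σ₆ ^ 2 * S.a ^ 2 := by positivity
    have : 0 ≤ S.σ₆ ^ 2 * S.l ^ 2 := by positivity
    nlinarith
  linarith

theorem threshold_sq_inner :
    2 * √(S.σ₄ ^ 2 * 2 * (3 * (S.a ^ 2 + S.l ^ 2))) + S.κ ^ 2 * 4 * (3 * (S.a ^ 2 + S.l ^ 2))
      ≤ 24 * (S.y ^ 2 * S.η) := by
  have h0 := S.η_mul_y_sq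
  have h3 := S.sq_add_sq_le
  have := S.one_le_a; have := S.one_le_l; have := S.σ₄_nonneg; have := S.q_nonneg
  have h1 : √(S.σ₄ ^ 2 * 2 * (3 * (S.a ^ 2 + S.l ^ 2))) ≤ 4 * (S.σ₄ * (S.a * S.l)) := by
    apply Real.sqrt_le_iff.2 ⟨by positivity, _⟩
    have : S.σ₄ ^ 2 * (S.a ^ 2 + S.l ^ 2) ≤ S.σ₄ ^ 2 * (2 * (S.a * S.l) ^ 2) := by gcongr
    have : 0 ≤ S.σ₄ ^ 2 * (S.a * S.l) ^ 2 := by positivity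
    nlinarith
  have h2 : S.κ ^ 2 * (S.a ^ 2 + S.l ^ 2) ≤ S.κ ^ 2 * (2 * (S.a ^ 2 * S.l ^ 2 + S.l ^ 4)) := by
    gcongr
    have : 0 ≤ S.l ^ 4 := by positivity
    rw [mul_pow] at h3
    linarith
  have : 0 ≤ S.σ₄ * (S.a * S.l) := by positivity
  linarith

theorem threshold_inner :
    2 * √(S.y ^ 2 * 2 * (3 * (S.a ^ 2 + S.l ^ 2))) + 1 * 4 * (3 * (S.a ^ 2 + S.l ^ 2))
      ≤ 32 * S.y ^ 2 := by
  have := S.one_le_a; have h1 := S.one_le_l; have hy := S.one_le_y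
  have h2 : S.a ^ 2 ≤ S.y ^ 2 := by gcongr; exact S.a_le_y
  have h3 : S.l ^ 2 ≤ S.y ^ 2 := by
    gcongr; simpa using S.l_pow_le_of_le (k := 1) (by norm_num)
  have h4 : √(S.y ^ 2 * 2 * (3 * (S.a ^ 2 + S.l ^ 2))) ≤ 4 * S.y ^ 2 := by
    apply Real.sqrt_le_iff.2 ⟨by positivity, _⟩
    have : S.y ^ 2 * (S.a ^ 2 + S.l ^ 2) ≤ S.y ^ 2 * (S.y ^ 2 + S.y ^ 2) := by gcongr
    have : 0 ≤ S.y ^ 4 := by positivity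
    nlinarith
  linarith

theorem two_mul_sqrt_add_le_W :
    2 * √(2 * S.a ^ 2 * (3 * S.l ^ 2)) + 12 * S.l ^ 2 ≤ S.W := by
  have := S.one_le_a; have := S.one_le_l
  have h1 : √(2 * S.a ^ 2 * (3 * S.l ^ 2)) ≤ 5 / 2 * (S.a * S.l) := by
    apply Real.sqrt_le_iff.2 ⟨by positivity, _⟩
    have : 0 ≤ (S.a * S.l) ^ 2 := sq_nonneg _
    nlinarith
  unfold W
  linarith

theorem sqrt_a_sq_le {x : ℝ} (hx : 0 ≤ x) :
    √(x ^ 2 * (2 * 10 ^ 5 * S.a ^ 2) * (3 * (S.a ^ 2 + S.l ^ 2)))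
      ≤ 1100 * (x * (S.a ^ 2 * S.l)) := by
  have := S.one_le_a; have := S.one_le_l
  apply Real.sqrt_le_iff.2 ⟨by positivity, _⟩
  have h1 : x ^ 2 * S.a ^ 2 * (S.a ^ 2 + S.l ^ 2) ≤ x ^ 2 * S.a ^ 2 * (2 * (S.a * S.l) ^ 2) := by
    gcongr; exact S.sq_add_sq_le
  have : 0 ≤ x ^ 2 * S.a ^ 2 * (S.a * S.l) ^ 2 := by positivity
  nlinarith

theorem threshold_truncDev_inner_sq :
    2 * √(S.y ^ 2 * (2 * 10 ^ 5 * S.a ^ 2) * (3 * (S.a ^ 2 + S.l ^ 2)))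
      + 1 * (16 * S.W) * (3 * (S.a ^ 2 + S.l ^ 2)) ≤ 5000 * (S.y ^ 4 * S.η) := by
  have h0 := S.η_mul_y_pow_four
  have ha := S.one_le_a; have hl := S.one_le_l; have hy := S.one_le_y
  have hW := S.W_nonneg
  have h1 := S.sqrt_a_sq_le (x := S.y) (by linarith)
  have h2 : S.W * (S.a ^ 2 + S.l ^ 2) ≤ 34 * (S.a ^ 2 * S.l * S.y + (S.a * S.l) ^ 3) := by
    -- W has the order of a l or of l², whichever is larger. In the second case l³ ≤ y brings l⁴
    -- below a² l y.
    rcases le_total S.l S.a with h | h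
    · calc S.W * (S.a ^ 2 + S.l ^ 2) ≤ 17 * (S.a * S.l) * (S.a ^ 2 + S.a ^ 2) := by
            gcongr; exact S.W_le_of_le h
        _ = 34 * (S.a ^ 3 * S.l ^ 1) := by ring
        _ ≤ 34 * (S.a ^ 3 * S.l ^ 3) := by gcongr; norm_num
        _ ≤ _ := by
          have : 0 ≤ S.a ^ 2 * S.l * S.y := by positivity
          rw [← mul_pow]; linarith
    · have h3 := S.l_pow_le_of_le (k := 3) (by norm_num)
      calc S.W * (S.a ^ 2 + S.l ^ 2) ≤ 17 * S.l ^ 2 * (S.l ^ 2 + S.l ^ 2) := by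
            gcongr; exact S.W_le_of_ge h
        _ = 34 * (1 * S.l * S.l ^ 3) := by ring
        _ ≤ 34 * (S.a ^ 2 * S.l * S.y) := by gcongr; exact one_le_pow₀ ha
        _ ≤ _ := by
          have : 0 ≤ (S.a * S.l) ^ 3 := by positivity
          linarith
  have h4 : 0 ≤ (S.a * S.l) ^ 3 := by positivity
  have h5 : S.y * (S.a ^ 2 * S.l) = S.a ^ 2 * S.l * S.y := by ring
  have : 0 ≤ S.a ^ 2 * S.l * S.y := by positivity
  linarith

theorem threshold_truncDev_inner_of_le (h : S.l ≤ S.a) :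
    2 * √(S.r ^ 2 * (S.W ^ 2 / 2) * (3 * (S.a ^ 2 + S.l ^ 2))) ≤ 5000 * (S.y ^ 3 * S.η) := by
  have h0 := S.η_mul_y_cube
  have ha := S.one_le_a; have hl := S.one_le_l; have hy := S.one_le_y; have hr := S.r_nonneg
  have hW := S.W_nonneg
  have h1 : √(S.r ^ 2 * (S.W ^ 2 / 2) * (3 * (S.a ^ 2 + S.l ^ 2))) ≤ 2 * (S.r * S.W * S.a) := by
    apply Real.sqrt_le_iff.2 ⟨by positivity, _⟩
    have : S.r ^ 2 * S.W ^ 2 * (S.a ^ 2 + S.l ^ 2) ≤ S.r ^ 2 * S.W ^ 2 * (S.a ^ 2 + S.a ^ 2) := by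
      gcongr
    have : 0 ≤ S.r ^ 2 * S.W ^ 2 * S.a ^ 2 := by positivity
    nlinarith
  have h2 : S.r * S.W * S.a ≤ S.r * (17 * (S.a * S.l)) * S.a := by
    gcongr; exact S.W_le_of_le h
  have h3 : S.r * (17 * (S.a * S.l)) * S.a = 17 * (S.r * (S.a ^ 2 * S.l)) := by ring
  have : 0 ≤ S.κ ^ 2 * (S.a ^ 2 * S.l ^ 2 + S.l ^ 4) * S.y := by positivity
  have : 0 ≤ S.a ^ 2 * S.l := by positivity
  have : 0 ≤ S.r * (S.a ^ 2 * S.l) := by positivity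
  linarith

theorem threshold_truncDev_inner_of_ge (h : S.a ≤ S.l) :
    2 * √(S.r ^ 2 * (2 * 10 ^ 5 * S.a ^ 2) * (3 * (S.a ^ 2 + S.l ^ 2)))
      + S.κ * (16 * S.W) * (3 * (S.a ^ 2 + S.l ^ 2)) ≤ 5000 * (S.y ^ 3 * S.η) := by
  have h0 := S.η_mul_y_cube
  have ha := S.one_le_a; have hl := S.one_le_l; have hy := S.one_le_y; have hr := S.r_nonneg
  have hW := S.W_nonneg; have hκ := S.κ_nonneg
  have h1 := S.sqrt_a_sq_le hr
  have h2 : S.κ * S.W * (S.a ^ 2 + S.l ^ 2) ≤ 17 * (S.κ ^ 2 * S.l ^ 4 * S.y + S.a ^ 2 * S.l) := by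
    calc S.κ * S.W * (S.a ^ 2 + S.l ^ 2) ≤ S.κ * (17 * S.l ^ 2) * (S.l ^ 2 + S.l ^ 2) := by
          gcongr; exact S.W_le_of_ge h
      _ = 17 * (2 * S.κ * S.l ^ 4) := by ring
      _ ≤ _ := by
        gcongr
        have h3 := S.l_pow_le_of_le (k := 4) (by norm_num)
        -- AM-GM splits the term linear in κ into the κ² term of η and l⁴/y, which is at most 1.
        have h4 : 2 * S.κ * S.l ^ 4 ≤ S.κ ^ 2 * S.l ^ 4 * S.y + S.l ^ 4 / S.y := by
          have : S.κ ^ 2 * S.l ^ 4 * S.y + S.l ^ 4 / S.y - 2 * S.κ * S.l ^ 4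
              = S.l ^ 4 * (S.κ * S.y - 1) ^ 2 / S.y := by field_simp; ring
          have : 0 ≤ S.l ^ 4 * (S.κ * S.y - 1) ^ 2 / S.y := by positivity
          linarith
        have h5 : S.l ^ 4 / S.y ≤ 1 := by rw [div_le_one (by linarith)]; exact h3
        have h6 : 1 ≤ S.a ^ 2 * S.l := by
          have := one_le_pow₀ (n := 2) ha
          nlinarith
        linarith
  have : 0 ≤ S.κ ^ 2 * (S.a ^ 2 * S.l ^ 2) * S.y := by positivity
  have : 0 ≤ S.κ ^ 2 * S.l ^ 4 * S.y := by positivity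
  have : 0 ≤ S.a ^ 2 * S.l := by positivity
  have : 0 ≤ S.r * (S.a ^ 2 * S.l) := by positivity
  linarith

end Scales


/-! ### The typical behaviour of the Gaussian rows -/

section GoodRows

variable {E : Type*} [NormedAddCommGroup E] [InnerProductSpace ℝ E] {ι : Type*} [Fintype ι]

/-- The bilinear form `∑ᵢ cᵢ ⟨x, hᵢ⟩⟨y, hᵢ⟩ - d ⟨x, y⟩`. -/
noncomputable def rowForm (c : ι → ℝ) (d : ℝ) (h : ι → E) : LinearMap.BilinForm ℝ E :=
  LinearMap.mk₂ ℝ (fun x y => ∑ i, c i * (inner ℝ x (h i) * inner ℝ y (h i)) - d * inner ℝ x y)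
    (fun x x' y => by
      simp only [inner_add_left, add_mul, mul_add, Finset.sum_add_distrib]; ring)
    (fun r x y => by
      simp only [real_inner_smul_left, smul_eq_mul, mul_sub, Finset.mul_sum]
      congr 1
      · exact Finset.sum_congr rfl fun i _ => by ring
      · ring)
    (fun x y y' => by
      simp only [inner_add_left, inner_add_right, mul_add, Finset.sum_add_distrib]; ring)
    (fun r x y => by
      simp only [real_inner_smul_left, real_inner_smul_right, smul_eq_mul, mul_sub, Finset.mul_sum]
      congr 1
      · exact Finset.sum_congr rfl fun i _ => by ring
      · ring)

theorem rowForm_apply (c : ι → ℝ) (d : ℝ) (h : ι → E) (x y : E) :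
    rowForm c d h x y = ∑ i, c i * (inner ℝ x (h i) * inner ℝ y (h i)) - d * inner ℝ x y := rfl

theorem rowForm_comm (c : ι → ℝ) (d : ℝ) (h : ι → E) (x y : E) :
    rowForm c d h x y = rowForm c d h y x := by
  simp only [rowForm_apply, real_inner_comm x y, mul_comm]

theorem rowForm_self (c : ι → ℝ) (d : ℝ) (h : ι → E) {u : E} (hu : ‖u‖ = 1) :
    rowForm c d h u u = ∑ i, c i * inner ℝ u (h i) ^ 2 - d := by
  rw [rowForm_apply, real_inner_self_eq_norm_sq, hu]
  simp [sq]

/-- The estimates on the rows `hᵢ` of a standard Gaussian matrix that the spectral method uses. -/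
structure GoodRows (S : Scales) (v : ι → ℝ) (h : ι → E) : Prop where
  normSqDev_le : |∑ i, v i ^ 2 * normSqDev (h i)| ≤ 10 ^ 7 * (S.y ^ 2 * S.η)
  cube_inner_le : ∀ x, |∑ i, v i ^ 3 * inner ℝ x (h i)| ≤ 10 ^ 7 * (S.y * S.η) * ‖x‖
  normSqDev_inner_le : ∀ x,
    |∑ i, v i * (normSqDev (h i) * inner ℝ x (h i))| ≤ 10 ^ 7 * (S.y ^ 3 * S.η) * ‖x‖
  sq_form_le : ∀ x y,
    |rowForm (fun i => v i ^ 2) (∑ i, v i ^ 2) h x y| ≤ 10 ^ 7 * (S.y ^ 2 * S.η) * ‖x‖ * ‖y‖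
  normSqDev_form_le : ∀ x y, |rowForm (fun i => normSqDev (h i)) (2 * S.y ^ 2) h x y|
    ≤ 10 ^ 7 * (S.y ^ 4 * S.η) * ‖x‖ * ‖y‖
  sum_sq_le : ∀ x, ∑ i, inner ℝ x (h i) ^ 2 ≤ 10 ^ 4 * S.y ^ 2 * ‖x‖ ^ 2

variable [FiniteDimensional ℝ E] [MeasurableSpace E] [BorelSpace E]

/-- One union bound over the rows ensures that no truncation is active, which gives the 2y²; six
further events of probability at most 2e^(-3l²) give the 12. Outside all seven, the net lemmas
extend the bounds from the net to all vectors. -/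
theorem measureReal_not_goodRows_le {S : Scales} {n : ℕ} (hn : 1 ≤ n) (hna : (n : ℝ) = S.a ^ 2)
    (hE : Module.finrank ℝ E ≤ n) (hN : (Fintype.card ι : ℝ) = S.y ^ 2)
    (hexp : S.y ^ 2 ≤ Real.exp (S.l ^ 2)) {v : ι → ℝ} (h2 : ∑ i, v i ^ 2 ≤ S.r ^ 2)
    (h4 : ∑ i, v i ^ 4 ≤ S.σ₄ ^ 2) (h6 : ∑ i, v i ^ 6 ≤ S.σ₆ ^ 2) (hκ : ∀ i, |v i| ≤ S.κ) :
    (Measure.pi fun _ : ι => stdGaussian E).real {h | ¬ GoodRows S v h}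
      ≤ (2 * S.y ^ 2 + 12) * Real.exp (-(3 * S.l ^ 2)) := by
  obtain ⟨T, hTcard, hT1, hT⟩ := exists_sphere_net E
  set π := Measure.pi fun _ : ι => stdGaussian E
  set m := Module.finrank ℝ E
  set c : E → ℝ := fun u => ∫ x, truncDev S.W x * inner ℝ u x ^ 2 ∂(stdGaussian E) with hc
  have ha := S.one_le_a
  have hl := S.one_le_l
  have hy := S.one_le_y
  have hη := S.η_pos
  have hW := S.W_nonneg
  have hκ0 := S.κ_nonneg
  have hmn : (m : ℝ) ≤ S.a ^ 2 := by rw [← hna]; exact_mod_cast hE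
  have hL : 0 < S.l ^ 2 := by positivity
  have hs : 2 * (m : ℝ) + 3 * S.l ^ 2 ≤ 3 * (S.a ^ 2 + S.l ^ 2) := by nlinarith
  have hs0 : 0 < 3 * (S.a ^ 2 + S.l ^ 2) := by positivity
  have hκ2 : ∀ i, |v i ^ 2| ≤ S.κ ^ 2 := fun i => by
    rw [abs_pow]; gcongr; exact hκ i
  have hκ3 : ∀ i, |v i ^ 3| ≤ S.κ ^ 3 := fun i => by
    rw [abs_pow]; gcongr; exact hκ i
  have h4' : ∑ i, (v i ^ 2) ^ 2 ≤ S.σ₄ ^ 2 := by simpa only [← pow_mul] using h4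
  have h6' : ∑ i, (v i ^ 3) ^ 2 ≤ S.σ₆ ^ 2 := by simpa only [← pow_mul] using h6
  have h1' : ∑ _i : ι, (1 : ℝ) ^ 2 ≤ S.y ^ 2 := by simp [hN]
  -- the exceptional events
  have b0 : π.real {h | ∃ i, S.W ≤ |normSqDev (h i)|}
      ≤ S.y ^ 2 * (2 * Real.exp (-(3 * S.l ^ 2))) := by
    rw [← hN]
    exact measureReal_exists_normSqDev_ge_le hE hL (by rw [hna]; exact S.two_mul_sqrt_add_le_W)
  have b1 : π.real {h | 12 * (S.y ^ 2 * S.η) ≤ |∑ i, v i ^ 2 * normSqDev (h i)|}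
      ≤ 2 * Real.exp (-(3 * S.l ^ 2)) := by
    have hB := ((hasBernsteinMGF_normSqDev (E := E)).mono (a' := 2 * S.a ^ 2) (by gcongr)
      le_rfl).weighted_sum (by positivity) (by norm_num) h4' hκ2
    exact hB.measureReal_abs_ge_le (by positivity) (by positivity) (by positivity)
      (by positivity) S.threshold_normSqDev
  have b2 : π.real {h | ∃ u ∈ T, 4 * (S.y * S.η) ≤ |∑ i, v i ^ 3 * inner ℝ u (h i)|}
      ≤ 2 * Real.exp (-(3 * S.l ^ 2)) := by
    refine measureReal_net_weighted_sum_le hTcard hT1 (f := fun u x => inner ℝ u x) (a := 1 / 2)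
      (b := 0) (fun u hu => by simpa [hu] using hasBernsteinMGF_inner u) (by norm_num) le_rfl h6'
      (by positivity) hκ3 hs hs0 (by positivity) ?_
    simpa using S.threshold_cube_inner
  have b3 : π.real {h | ∃ u ∈ T, 5000 * (S.y ^ 3 * S.η)
      ≤ |∑ i, v i * (truncDev S.W (h i) * inner ℝ u (h i))|} ≤ 2 * Real.exp (-(3 * S.l ^ 2)) := by
    -- For l ≤ a the sub-Gaussian estimate costs about W a ≲ a² l, as η allows. For a ≤ l it would
    -- cost l³, so the variance proxy of order n is used instead.
    rcases le_total S.l S.a with hla | hla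
    · refine measureReal_net_weighted_sum_le hTcard hT1
        (f := fun u x => truncDev S.W x * inner ℝ u x)
        (fun u hu => hasBernsteinMGF_truncDev_mul_inner_subgaussian hu hW) (by positivity) le_rfl
        h2 hκ0 hκ hs hs0 (by positivity) ?_
      simpa using S.threshold_truncDev_inner_of_le hla
    · refine measureReal_net_weighted_sum_le hTcard hT1
        (f := fun u x => truncDev S.W x * inner ℝ u x)
        (fun u hu => hasBernsteinMGF_truncDev_mul_inner hn hE hu hW) (by positivity) (by positivity)
        h2 hκ0 hκ hs hs0 (by positivity) ?_
      rw [hna]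
      exact S.threshold_truncDev_inner_of_ge hla
  have b4 : π.real {h | ∃ u ∈ T, 24 * (S.y ^ 2 * S.η)
      ≤ |∑ i, v i ^ 2 * (inner ℝ u (h i) ^ 2 - 1)|} ≤ 2 * Real.exp (-(3 * S.l ^ 2)) :=
    measureReal_net_weighted_sum_le hTcard hT1 (f := fun u x => inner ℝ u x ^ 2 - 1)
      (fun u hu => hasBernsteinMGF_inner_sq hu) (by norm_num) (by norm_num) h4'
      (by positivity) hκ2 hs hs0 (by positivity) S.threshold_sq_inner
  have b5 : π.real {h | ∃ u ∈ T, 5000 * (S.y ^ 4 * S.η)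
      ≤ |∑ i, 1 * (truncDev S.W (h i) * inner ℝ u (h i) ^ 2 - c u)|}
      ≤ 2 * Real.exp (-(3 * S.l ^ 2)) := by
    refine measureReal_net_weighted_sum_le hTcard hT1
      (f := fun u x => truncDev S.W x * inner ℝ u x ^ 2 - c u)
      (fun u hu => hasBernsteinMGF_truncDev_mul_inner_sq hn hE hu hW) (by positivity)
      (by positivity) h1' zero_le_one (fun _ => by simp) hs hs0 (by positivity) ?_
    rw [hna]
    exact S.threshold_truncDev_inner_sq
  have b6 : π.real {h | ∃ u ∈ T, 32 * S.y ^ 2 ≤ |∑ i, 1 * (inner ℝ u (h i) ^ 2 - 1)|}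
      ≤ 2 * Real.exp (-(3 * S.l ^ 2)) :=
    measureReal_net_weighted_sum_le hTcard hT1 (f := fun u x => inner ℝ u x ^ 2 - 1)
      (fun u hu => hasBernsteinMGF_inner_sq hu) (by norm_num) (by norm_num) h1'
      zero_le_one (fun _ => by simp) hs hs0 (by positivity) S.threshold_inner
  -- the truncation bias
  have hbias : ∀ u ∈ T, S.y ^ 2 * |c u - 2| ≤ 3 * 10 ^ 5 * (S.y ^ 4 * S.η) := fun u hu => by
    -- With r = y² = N, the bias summed over N rows is at most N² times the tail probability plus a
    -- multiple of n; the first is bounded thanks to `hexp`.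
    have h1 := abs_integral_truncDev_sub_two_le hn hE (hT1 u hu) hW (r := S.y ^ 2) (by positivity)
    have h2 := measureReal_normSqDev_ge_le (E := E) (W := S.W) hE hL
      (by rw [hna]; exact S.two_mul_sqrt_add_le_W)
    have h3 := S.η_mul_y_pow_four
    rw [hna] at h1
    have h5 : (S.y ^ 2) ^ 2 * Real.exp (-(3 * S.l ^ 2)) ≤ 1 := by
      rw [Real.exp_neg, mul_inv_le_iff₀ (Real.exp_pos _), one_mul]
      calc (S.y ^ 2) ^ 2 ≤ Real.exp (S.l ^ 2) ^ 2 := by gcongr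
        _ ≤ Real.exp (S.l ^ 2) ^ 3 :=
          pow_le_pow_right₀ (Real.one_le_exp (by positivity)) (by norm_num)
        _ = _ := by rw [← Real.exp_nat_mul]; norm_num
    have h6 : 1 ≤ S.a ^ 2 := one_le_pow₀ ha
    have h7 : S.a ^ 2 ≤ S.a ^ 2 * S.l * S.y := by
      rw [mul_assoc]; exact le_mul_of_one_le_right (by positivity) (one_le_mul_of_one_le_of_one_le hl hy)
    have h8 : 0 ≤ (S.a * S.l) ^ 3 := by positivity
    calc S.y ^ 2 * |c u - 2|
        ≤ S.y ^ 2 * (S.y ^ 2 * (2 * Real.exp (-(3 * S.l ^ 2)))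
          + 2 * 10 ^ 5 * S.a ^ 2 / S.y ^ 2) := by
          gcongr
          refine h1.trans ?_
          gcongr
      _ = 2 * ((S.y ^ 2) ^ 2 * Real.exp (-(3 * S.l ^ 2))) + 2 * 10 ^ 5 * S.a ^ 2 := by
          field_simp
      _ ≤ _ := by linarith
  have hsub : {h | ¬ GoodRows S v h} ⊆
      {h | ∃ i, S.W ≤ |normSqDev (h i)|} ∪
      ({h | 12 * (S.y ^ 2 * S.η) ≤ |∑ i, v i ^ 2 * normSqDev (h i)|} ∪
      ({h | ∃ u ∈ T, 4 * (S.y * S.η) ≤ |∑ i, v i ^ 3 * inner ℝ u (h i)|} ∪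
      ({h | ∃ u ∈ T, 5000 * (S.y ^ 3 * S.η)
        ≤ |∑ i, v i * (truncDev S.W (h i) * inner ℝ u (h i))|} ∪
      ({h | ∃ u ∈ T, 24 * (S.y ^ 2 * S.η) ≤ |∑ i, v i ^ 2 * (inner ℝ u (h i) ^ 2 - 1)|} ∪
      ({h | ∃ u ∈ T, 5000 * (S.y ^ 4 * S.η)
        ≤ |∑ i, 1 * (truncDev S.W (h i) * inner ℝ u (h i) ^ 2 - c u)|} ∪
      {h | ∃ u ∈ T, 32 * S.y ^ 2 ≤ |∑ i, 1 * (inner ℝ u (h i) ^ 2 - 1)|}))))) := by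
    intro h hbad
    contrapose! hbad
    simp only [Set.mem_union, Set.mem_ofPred_eq, not_or, not_exists, not_and, not_le] at hbad
    obtain ⟨g0, g1, g2, g3, g4, g5, g6⟩ := hbad
    -- Outside the first event no row is truncated, so the truncated sums are the original ones.
    simp only [truncDev_of_le (g0 _).le] at g3 g5
    rw [Set.mem_ofPred_eq, not_not]
    have p1 : 0 < S.y * S.η := by positivity
    have p2 : 0 < S.y ^ 2 * S.η := by positivity
    have p3 : 0 < S.y ^ 3 * S.η := by positivity
    have p4 : 0 < S.y ^ 4 * S.η := by positivity
    refine ⟨by linarith, fun x => ?_, fun x => ?_, fun x x' => ?_, fun x x' => ?_, fun x => ?_⟩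
    · have key := abs_inner_le_of_net hT (z := ∑ i, v i ^ 3 • h i) (t := 4 * (S.y * S.η))
        (by positivity) (fun u hu => by
          simpa only [inner_sum, real_inner_smul_right] using (g2 u hu).le) x
      simp only [inner_sum, real_inner_smul_right] at key
      exact key.trans (mul_le_mul_of_nonneg_right (by linarith) (norm_nonneg _))
    · have key := abs_inner_le_of_net hT (z := ∑ i, (v i * normSqDev (h i)) • h i)
        (t := 5000 * (S.y ^ 3 * S.η)) (by positivity) (fun u hu => by
          simpa only [inner_sum, real_inner_smul_right, mul_assoc] using (g3 u hu).le) x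
      simp only [inner_sum, real_inner_smul_right, mul_assoc (v _)] at key
      exact key.trans (mul_le_mul_of_nonneg_right (by linarith) (norm_nonneg _))
    · refine (abs_bilin_le_of_net hT1 hT (rowForm_comm _ _ h) (t := 24 * (S.y ^ 2 * S.η))
        (fun u hu => ?_) x x').trans ?_
      · rw [rowForm_self _ _ _ (hT1 u hu), ← Finset.sum_sub_distrib]
        simpa only [mul_sub, mul_one] using (g4 u hu).le
      · exact mul_le_mul_of_nonneg_right (mul_le_mul_of_nonneg_right (by linarith)
          (norm_nonneg _)) (norm_nonneg _)
    · refine (abs_bilin_le_of_net hT1 hT (rowForm_comm _ _ h)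
        (t := 5000 * (S.y ^ 4 * S.η) + 3 * 10 ^ 5 * (S.y ^ 4 * S.η)) (fun u hu => ?_) x x').trans ?_
      · rw [rowForm_self _ _ _ (hT1 u hu)]
        -- Concentration holds around the truncated mean c u; recentring at 2 costs the bias. The
        -- passage from the net gives the largest constant, 32 · (5000 + 3·10⁵) ≤ 10⁷.
        have e : ∑ i, normSqDev (h i) * inner ℝ u (h i) ^ 2 - 2 * S.y ^ 2
            = ∑ i, 1 * (normSqDev (h i) * inner ℝ u (h i) ^ 2 - c u) + S.y ^ 2 * (c u - 2) := by
          simp only [one_mul, Finset.sum_sub_distrib, Finset.sum_const, nsmul_eq_mul,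
            Finset.card_univ, hN]
          ring
        rw [e]
        refine (abs_add_le _ _).trans (add_le_add (g5 u hu).le ?_)
        rw [abs_mul, abs_of_nonneg (by positivity : 0 ≤ S.y ^ 2)]
        exact hbias u hu
      · exact mul_le_mul_of_nonneg_right (mul_le_mul_of_nonneg_right (by linarith)
          (norm_nonneg _)) (norm_nonneg _)
    · have key := abs_bilin_le_of_net hT1 hT (rowForm_comm (fun _ => 1) (S.y ^ 2) h)
        (t := 32 * S.y ^ 2) (fun u hu => by
          rw [rowForm_self _ _ _ (hT1 u hu)]
          have := (g6 u hu).le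
          simpa only [one_mul, Finset.sum_sub_distrib, Finset.sum_const, nsmul_eq_mul,
            Finset.card_univ, hN, mul_one] using this) x x
      rw [rowForm_apply, real_inner_self_eq_norm_sq] at key
      have key' := (abs_le.1 key).2
      simp only [one_mul, ← sq] at key'
      have : 0 ≤ S.y ^ 2 * ‖x‖ ^ 2 := by positivity
      linarith
  refine (measureReal_mono hsub).trans ?_
  refine (measureReal_union_le _ _).trans ((add_le_add b0 ((measureReal_union_le _ _).trans
    (add_le_add b1 ((measureReal_union_le _ _).trans (add_le_add b2
    ((measureReal_union_le _ _).trans (add_le_add b3 ((measureReal_union_le _ _).trans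
    (add_le_add b4 ((measureReal_union_le _ _).trans (add_le_add b5 b6))))))))))).trans ?_)
  linarith

end GoodRows


/-! ### Perturbation of the leading eigenvector -/

section Perturbation

variable {N n : ℕ}

theorem inner_eq_dotProduct {ι : Type*} [Fintype ι] (x y : EuclideanSpace ℝ ι) :
    inner ℝ x y = WithLp.ofLp x ⬝ᵥ WithLp.ofLp y := by
  rw [EuclideanSpace.inner_eq_star_dotProduct, dotProduct_comm]; rfl

theorem IsLeadingEigenvector.abs_dotProduct_le {M : Matrix (Fin n) (Fin n) ℝ} (hM : M.IsSymm)
    {l : ℝ} (hl : ∀ μ : ℝ, Module.End.HasEigenvalue (Matrix.toLin' M) μ → |μ| ≤ |l|)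
    (x : EuclideanSpace ℝ (Fin n)) : |x.ofLp ⬝ᵥ M *ᵥ x.ofLp| ≤ |l| * ‖x‖ ^ 2 := by
  have hH : M.IsHermitian := by
    rw [Matrix.IsHermitian, Matrix.conjTranspose_eq_transpose_of_trivial]; exact hM
  set b := hH.eigenvectorBasis
  have hev : ∀ i, |hH.eigenvalues i| ≤ |l| := fun i => by
    apply hl
    refine Module.End.hasEigenvalue_of_hasEigenvector (x := (b i).ofLp) ?_
    rw [Module.End.hasEigenvector_iff, Module.End.mem_eigenspace_iff]
    refine ⟨?_, fun h => ?_⟩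
    · rw [Matrix.toLin'_apply]; exact hH.mulVec_eigenvectorBasis i
    · have h1 := b.orthonormal.1 i
      rw [show b i = 0 from (WithLp.ofLp_injective 2) h] at h1
      simp at h1
  have hsum : x.ofLp ⬝ᵥ M *ᵥ x.ofLp = ∑ i, hH.eigenvalues i * inner ℝ (b i) x ^ 2 := by
    have h1 : x.ofLp ⬝ᵥ M *ᵥ x.ofLp = inner ℝ x (WithLp.toLp 2 (M *ᵥ x.ofLp)) := by
      rw [inner_eq_dotProduct]
    rw [h1, ← b.sum_inner_mul_inner]
    refine Finset.sum_congr rfl fun i _ => ?_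
    have h2 : inner ℝ (b i) (WithLp.toLp 2 (M *ᵥ x.ofLp))
        = hH.eigenvalues i * inner ℝ (b i) x := by
      rw [inner_eq_dotProduct, inner_eq_dotProduct, Matrix.dotProduct_mulVec,
        ← Matrix.mulVec_transpose, hM.eq, hH.mulVec_eigenvectorBasis, smul_dotProduct, smul_eq_mul]
    rw [h2, real_inner_comm]
    ring
  rw [hsum, ← b.sum_sq_inner_right x, Finset.mul_sum]
  refine (Finset.abs_sum_le_sum_abs _ _).trans (Finset.sum_le_sum fun i _ => ?_)
  rw [abs_mul, abs_of_nonneg (sq_nonneg (inner ℝ (b i) x))]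
  exact mul_le_mul_of_nonneg_right (hev i) (sq_nonneg _)

/-- A Davis–Kahan argument by hand. The Rayleigh quotient at e gives |l| ≥ |θ| - ε. Pairing the
eigenvalue equation with the component p of u orthogonal to e removes the rank-one part, so |l|‖p‖²
≤ ε‖p‖, hence ‖p‖ ≤ 2ε/|θ| when ε ≤ |θ|/2. -/
theorem IsLeadingEigenvector.norm_sub_single_le {M : Matrix (Fin n) (Fin n) ℝ} (hM : M.IsSymm)
    {z : Fin n} {θ ε : ℝ} (hθ : θ ≠ 0)
    (hform : ∀ x y : EuclideanSpace ℝ (Fin n),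
      |x.ofLp ⬝ᵥ M *ᵥ y.ofLp - θ * (x z * y z)| ≤ ε * ‖x‖ * ‖y‖)
    {u : EuclideanSpace ℝ (Fin n)} (hu : IsLeadingEigenvector M u) :
    ‖u - EuclideanSpace.single z 1‖ ≤ 4 * ε / |θ| ∨
      ‖-u - EuclideanSpace.single z 1‖ ≤ 4 * ε / |θ| := by
  obtain ⟨hu1, l, hul, hmax⟩ := hu
  set e : EuclideanSpace ℝ (Fin n) := EuclideanSpace.single z 1 with he
  have he1 : ‖e‖ = 1 := by simp [he]
  -- If ε > |θ|/2, the bound exceeds 2 and holds for any unit vector; this is the first case below.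
  have hθ0 : 0 < |θ| := abs_pos.2 hθ
  have hez : e z = 1 := by simp [he]
  rcases lt_or_ge (|θ| / 2) ε with hε | hε
  · left
    rw [le_div_iff₀ hθ0]
    have := norm_sub_le u e
    rw [hu1, he1] at this
    nlinarith
  have hl : |θ| - ε ≤ |l| := by
    have h1 := hform e e
    have h2 := IsLeadingEigenvector.abs_dotProduct_le hM hmax e
    rw [he1, hez] at h1
    rw [he1] at h2
    have h3 := abs_sub_abs_le_abs_sub θ (e.ofLp ⬝ᵥ M *ᵥ e.ofLp)
    rw [abs_sub_comm] at h3
    norm_num at h1 h2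
    linarith
  set p : EuclideanSpace ℝ (Fin n) := u - u z • e with hp
  have hpz : p z = 0 := by simp [hp, he]
  have hpe : inner ℝ p e = 0 := by
    rw [he, EuclideanSpace.inner_single_right]; simp [hpz]
  have hsq : ‖p‖ ^ 2 + u z ^ 2 = 1 := by
    have h1 : u = p + u z • e := by simp [hp]
    have h2 := norm_add_sq_real p (u z • e)
    rw [← h1, hu1, real_inner_smul_right, hpe, norm_smul, he1] at h2
    rw [Real.norm_eq_abs] at h2
    nlinarith [sq_abs (u z)]
  have hpl : (|θ| - ε) * ‖p‖ ≤ ε := by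
    rcases eq_or_ne p 0 with h0 | h0
    · rw [h0, norm_zero, mul_zero]
      have := (abs_nonneg _).trans (hform e e)
      rw [he1] at this; linarith
    have h1 := hform p u
    rw [hpz, hul, dotProduct_smul, ← inner_eq_dotProduct] at h1
    have h2 : inner ℝ p u = ‖p‖ ^ 2 := by
      have h3 : u = p + u z • e := by simp [hp]
      rw [h3, inner_add_right, real_inner_smul_right, hpe, real_inner_self_eq_norm_sq]; simp
    rw [h2, hu1] at h1
    simp only [smul_eq_mul, zero_mul, mul_zero, sub_zero, mul_one, abs_mul, abs_pow, abs_norm] at h1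
    have h4 : 0 < ‖p‖ := norm_pos_iff.2 h0
    have h5 : |l| * ‖p‖ ≤ ε := by
      by_contra! h; nlinarith
    nlinarith
  have hp2 : ‖p‖ ≤ 2 * ε / |θ| := by
    rw [le_div_iff₀ hθ0]; nlinarith [norm_nonneg p]
  have hfin : ∀ w : EuclideanSpace ℝ (Fin n), ∀ s : ℝ, 0 ≤ s → s ^ 2 = u z ^ 2 →
      ‖w - s • e‖ = ‖p‖ → ‖w - e‖ ≤ 4 * ε / |θ| := fun w s hs hsu hw => by
    have h1 : w - e = (w - s • e) + (s - 1) • e := by rw [sub_smul, one_smul]; abel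
    have hp1 : ‖p‖ ≤ 1 := by nlinarith [norm_nonneg p, sq_nonneg (u z)]
    -- For s in [0,1], 1 - s ≤ 1 - s² = ‖p‖² ≤ ‖p‖.
    have h2 : |s - 1| ≤ ‖p‖ := by
      have h3 : s ≤ 1 := by nlinarith [norm_nonneg p, sq_nonneg ‖p‖]
      rw [abs_of_nonpos (by linarith)]
      nlinarith [norm_nonneg p]
    calc ‖w - e‖ ≤ ‖w - s • e‖ + ‖(s - 1) • e‖ := by rw [h1]; exact norm_add_le _ _
      _ = ‖p‖ + |s - 1| := by rw [hw, norm_smul, he1, mul_one, Real.norm_eq_abs]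
      _ ≤ 2 * ε / |θ| + 2 * ε / |θ| := by linarith
      _ = _ := by ring
  rcases le_total 0 (u z) with h | h
  · exact Or.inl (hfin u (u z) h rfl rfl)
  · refine Or.inr (hfin (-u) (-u z) (by linarith) (by ring) ?_)
    rw [neg_smul, ← neg_sub', norm_neg]

/-! ### Rotations of the observation -/

theorem mulVec_spectralMatrix (Y : Matrix (Fin N) (Fin n) ℝ) (x y : Fin n → ℝ) :
    x ⬝ᵥ spectralMatrix Y *ᵥ y = ∑ i, (‖WithLp.toLp 2 (Y i)‖ ^ 2 - ((n : ℝ) - 1) / N) *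
      ((Y i ⬝ᵥ x) * (Y i ⬝ᵥ y)) - 3 / N * (x ⬝ᵥ y) := by
  simp only [spectralMatrix, Matrix.sub_mulVec, Matrix.sum_mulVec, Matrix.smul_mulVec,
    Matrix.one_mulVec, dotProduct_sub, dotProduct_sum, dotProduct_smul, Matrix.vecMulVec_mulVec,
    smul_eq_mul]
  congr 1
  refine Finset.sum_congr rfl fun i _ => ?_
  simp [dotProduct_comm x]

theorem isSymm_spectralMatrix (Y : Matrix (Fin N) (Fin n) ℝ) : (spectralMatrix Y).IsSymm := by
  simp only [Matrix.IsSymm, spectralMatrix, Matrix.transpose_sub, Matrix.transpose_sum,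
    Matrix.transpose_smul, Matrix.transpose_one, Matrix.transpose_vecMulVec]

/-- Row norms are invariant under Q, so the weights do not change and only the rank-one factors
rotate. -/
theorem spectralMatrix_mul (Y : Matrix (Fin N) (Fin n) ℝ) {Q : Matrix (Fin n) (Fin n) ℝ}
    (hQ : Q ∈ Matrix.orthogonalGroup (Fin n) ℝ) :
    spectralMatrix (Y * Q) = Qᵀ * spectralMatrix Y * Q := by
  have hQ1 : Qᵀ * Q = 1 := (Matrix.mem_orthogonalGroup_iff' (Fin n) ℝ).1 hQ
  have hQ2 : Q * Qᵀ = 1 := (Matrix.mem_orthogonalGroup_iff (Fin n) ℝ).1 hQ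
  have hrow : ∀ i, (Y * Q) i = Y i ᵥ* Q := fun i => rfl
  have hnorm : ∀ i, ‖WithLp.toLp 2 ((Y * Q) i)‖ ^ 2 = ‖WithLp.toLp 2 (Y i)‖ ^ 2 := fun i => by
    rw [← real_inner_self_eq_norm_sq, ← real_inner_self_eq_norm_sq, inner_eq_dotProduct,
      inner_eq_dotProduct, hrow]
    simp only
    rw [← Matrix.dotProduct_mulVec, ← Matrix.mulVec_transpose Q, Matrix.mulVec_mulVec, hQ2,
      Matrix.one_mulVec]
  have hvec : ∀ i, Matrix.vecMulVec ((Y * Q) i) ((Y * Q) i)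
      = Qᵀ * Matrix.vecMulVec (Y i) (Y i) * Q := fun i => by
    rw [hrow, Matrix.mul_vecMulVec, Matrix.vecMulVec_mul, Matrix.mulVec_transpose]
  simp only [spectralMatrix, hnorm, hvec, Matrix.mul_sub, Matrix.sub_mul, Matrix.mul_sum,
    Matrix.sum_mul, Matrix.mul_smul, Matrix.smul_mul, Matrix.mul_one, hQ1]

theorem IsLeadingEigenvector.of_mul {Y : Matrix (Fin N) (Fin n) ℝ} {Q : Matrix (Fin n) (Fin n) ℝ}
    (hQ : Q ∈ Matrix.orthogonalGroup (Fin n) ℝ) {u : EuclideanSpace ℝ (Fin n)}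
    (hu : IsLeadingEigenvector (spectralMatrix (Y * Q)) u) :
    IsLeadingEigenvector (spectralMatrix Y) (WithLp.toLp 2 (Q *ᵥ u.ofLp)) := by
  have hQ1 : Qᵀ * Q = 1 := (Matrix.mem_orthogonalGroup_iff' (Fin n) ℝ).1 hQ
  have hQ2 : Q * Qᵀ = 1 := (Matrix.mem_orthogonalGroup_iff (Fin n) ℝ).1 hQ
  obtain ⟨hu1, l, hul, hmax⟩ := hu
  rw [spectralMatrix_mul Y hQ] at hul hmax
  refine ⟨?_, l, ?_, fun μ hμ => hmax μ ?_⟩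
  · have h1 : ‖WithLp.toLp 2 (Q *ᵥ u.ofLp)‖ ^ 2 = ‖u‖ ^ 2 := by
      rw [← real_inner_self_eq_norm_sq, ← real_inner_self_eq_norm_sq, inner_eq_dotProduct,
        inner_eq_dotProduct]
      simp only
      rw [Matrix.dotProduct_mulVec, ← Matrix.mulVec_transpose Q, Matrix.mulVec_mulVec, hQ1,
        Matrix.one_mulVec]
    rw [hu1, one_pow] at h1
    exact (pow_eq_one_iff_of_nonneg (norm_nonneg _) two_ne_zero).1 h1
  · have h1 := congrArg (fun x => Q *ᵥ x) hul
    simp only [Matrix.mulVec_mulVec, Matrix.mulVec_smul] at h1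
    rw [← Matrix.mul_assoc, ← Matrix.mul_assoc, hQ2, Matrix.one_mul] at h1
    simpa only [Matrix.mulVec_mulVec] using h1
  · obtain ⟨x, hx⟩ := hμ.exists_hasEigenvector
    rw [Module.End.hasEigenvector_iff, Module.End.mem_eigenspace_iff, Matrix.toLin'_apply] at hx
    refine Module.End.hasEigenvalue_of_hasEigenvector (x := Qᵀ *ᵥ x) ?_
    rw [Module.End.hasEigenvector_iff, Module.End.mem_eigenspace_iff, Matrix.toLin'_apply]
    refine ⟨?_, fun h => hx.2 ?_⟩
    · rw [Matrix.mulVec_mulVec, Matrix.mul_assoc, hQ2, Matrix.mul_one, ← Matrix.mulVec_mulVec, hx.1,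
        Matrix.mulVec_smul]
    · have h1 := congrArg (fun x => Q *ᵥ x) h
      simpa only [Matrix.mulVec_mulVec, hQ2, Matrix.one_mulVec, Matrix.mulVec_zero] using h1

theorem estimator_mul (Y : Matrix (Fin N) (Fin n) ℝ) (Q : Matrix (Fin n) (Fin n) ℝ)
    (u : EuclideanSpace ℝ (Fin n)) :
    estimator (Y * Q) u = estimator Y (WithLp.toLp 2 (Q *ᵥ u.ofLp)) := by
  simp [estimator, Matrix.mulVec_mulVec]

theorem estimator_sub (Y : Matrix (Fin N) (Fin n) ℝ) (u w : EuclideanSpace ℝ (Fin n)) :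
    estimator Y (u - w) = estimator Y u - estimator Y w := by
  simp [estimator, Matrix.mulVec_sub]

/-- Since Y e = v, the error is Y(u - e) after rotating back. The second bound uses only ‖u - e‖ ≤
2; it covers the unit-vector regime where the claimed rate is trivial. -/
theorem spectralErrorLE_of_form {Y : Matrix (Fin N) (Fin n) ℝ} {v : EuclideanSpace ℝ (Fin N)}
    {z : Fin n} (hz : ∀ i, Y i z = v i) {θ ε K : ℝ} (hθ : θ ≠ 0)
    (hform : ∀ x y : EuclideanSpace ℝ (Fin n),
      |x.ofLp ⬝ᵥ spectralMatrix Y *ᵥ y.ofLp - θ * (x z * y z)| ≤ ε * ‖x‖ * ‖y‖)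
    (hK : ∀ x, ‖estimator Y x‖ ≤ K * ‖x‖) (hK0 : 0 ≤ K) :
    SpectralErrorLE Y v (K * (4 * ε / |θ|)) ∧ SpectralErrorLE Y v (K * 2) := by
  have hv : estimator Y (EuclideanSpace.single z 1) = v := by
    ext i; simp [estimator, hz]
  have hneg : ∀ (Q : Matrix (Fin n) (Fin n) ℝ) (u : EuclideanSpace ℝ (Fin n)),
      WithLp.toLp 2 (Q *ᵥ (-u).ofLp) = -WithLp.toLp 2 (Q *ᵥ u.ofLp) := fun Q u => by
    simp [Matrix.mulVec_neg]
  constructor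
  · intro Q hQ u hu
    rw [estimator_mul, estimator_mul, hneg, ← hv, ← estimator_sub, ← estimator_sub]
    refine (IsLeadingEigenvector.norm_sub_single_le (isSymm_spectralMatrix Y) hθ hform
      (hu.of_mul hQ)).imp (fun h => ?_) (fun h => ?_) <;>
    exact (hK _).trans (by gcongr)
  · intro Q hQ u hu
    left
    rw [estimator_mul, ← hv, ← estimator_sub]
    refine (hK _).trans ?_
    gcongr
    refine (norm_sub_le _ _).trans ?_
    rw [(hu.of_mul hQ).1]
    norm_num

end Perturbation


/-! ### The Gaussian rows of the observation -/

section Rows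

variable {N n : ℕ}

/-- The rows of the Gaussian part of `Y`, normalized to have standard Gaussian entries. -/
noncomputable def gaussianRows (Y : Matrix (Fin N) (Fin n) ℝ) (i : Fin N) :
    EuclideanSpace ℝ {j : Fin n // (j : ℕ) ≠ 0} :=
  WithLp.toLp 2 fun j => √(N : ℝ) * Y i j

/-- The coordinates of `x` along the Gaussian columns. -/
noncomputable def gaussianPart (x : EuclideanSpace ℝ (Fin n)) :
    EuclideanSpace ℝ {j : Fin n // (j : ℕ) ≠ 0} :=
  WithLp.toLp 2 fun j => x j

theorem finrank_gaussianRows (hn : 1 ≤ n) :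
    Module.finrank ℝ (EuclideanSpace ℝ {j : Fin n // (j : ℕ) ≠ 0}) + 1 = n := by
  have h : ∀ j : Fin n, (j : ℕ) ≠ 0 ↔ j ≠ ⟨0, hn⟩ := fun j => by simp [Fin.ext_iff]
  rw [finrank_euclideanSpace, Fintype.card_congr (Equiv.subtypeEquivRight h)]
  simp only [ne_eq, Fintype.card_subtype_compl, Fintype.card_fin, Fintype.card_unique]
  omega

theorem sum_eq_zero_add_sum (hn : 1 ≤ n) (f : Fin n → ℝ) :
    ∑ j, f j = f ⟨0, hn⟩ + ∑ j : {j : Fin n // (j : ℕ) ≠ 0}, f j := by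
  rw [Fintype.sum_eq_add_sum_subtype_ne f ⟨0, hn⟩]
  congr 1
  exact Fintype.sum_equiv (Equiv.subtypeEquivRight fun j => by simp [Fin.ext_iff]) _ _ fun _ => rfl

theorem norm_sq_eq_add (hn : 1 ≤ n) (x : EuclideanSpace ℝ (Fin n)) :
    ‖x‖ ^ 2 = x ⟨0, hn⟩ ^ 2 + ‖gaussianPart x‖ ^ 2 := by
  rw [EuclideanSpace.real_norm_sq_eq, EuclideanSpace.real_norm_sq_eq, sum_eq_zero_add_sum hn]
  rfl

theorem norm_gaussianPart_le (hn : 1 ≤ n) (x : EuclideanSpace ℝ (Fin n)) :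
    ‖gaussianPart x‖ ≤ ‖x‖ := by
  have := norm_sq_eq_add hn x
  exact abs_le_of_sq_le_sq' (by nlinarith [sq_nonneg (x ⟨0, hn⟩)]) (norm_nonneg x) |>.2

theorem dotProduct_eq_add (hn : 1 ≤ n) (x y : EuclideanSpace ℝ (Fin n)) :
    x.ofLp ⬝ᵥ y.ofLp = x ⟨0, hn⟩ * y ⟨0, hn⟩ + inner ℝ (gaussianPart x) (gaussianPart y) := by
  rw [inner_eq_dotProduct, dotProduct, sum_eq_zero_add_sum hn]
  rfl

variable {Y : Matrix (Fin N) (Fin n) ℝ} {v : EuclideanSpace ℝ (Fin N)} (hn : 1 ≤ n)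
  (hY : ∀ i, Y i ⟨0, hn⟩ = v i) (hN : 0 < N)

include hY hN

theorem row_dotProduct (i : Fin N) (x : EuclideanSpace ℝ (Fin n)) :
    Y i ⬝ᵥ x.ofLp = v i * x ⟨0, hn⟩
      + inner ℝ (gaussianPart x) (gaussianRows Y i) / √(N : ℝ) := by
  have hN' : 0 < √(N : ℝ) := Real.sqrt_pos.2 (by exact_mod_cast hN)
  rw [inner_eq_dotProduct, dotProduct, sum_eq_zero_add_sum hn, hY, dotProduct, Finset.sum_div]
  congr 1
  refine Finset.sum_congr rfl fun j _ => ?_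
  simp only [gaussianPart, gaussianRows]
  field_simp

theorem row_norm_sq_sub (i : Fin N) :
    ‖WithLp.toLp 2 (Y i)‖ ^ 2 - ((n : ℝ) - 1) / N
      = v i ^ 2 + normSqDev (gaussianRows Y i) / N := by
  have hN' : (0 : ℝ) < N := by exact_mod_cast hN
  have h1 : ((n : ℝ) - 1) = Module.finrank ℝ (EuclideanSpace ℝ {j : Fin n // (j : ℕ) ≠ 0}) := by
    rw [sub_eq_iff_eq_add]; exact_mod_cast (finrank_gaussianRows hn).symm
  have h2 : ‖gaussianRows Y i‖ ^ 2 = N * ‖gaussianPart (WithLp.toLp 2 (Y i))‖ ^ 2 := by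
    rw [EuclideanSpace.real_norm_sq_eq, EuclideanSpace.real_norm_sq_eq, Finset.mul_sum]
    refine Finset.sum_congr rfl fun j _ => ?_
    simp only [gaussianPart, gaussianRows]
    rw [mul_pow, Real.sq_sqrt hN'.le]
  rw [norm_sq_eq_add hn, normSqDev, h1, h2]
  simp only [hY]
  field_simp
  ring

/-- The identity M = θ e eᵀ + error. Both forms on the right are centred at their means, ‖v‖² and
2N; after division by N and N² these add up to (‖v‖² + 2)/N, and the shift 3/N leaves the last term.
-/
theorem dotProduct_spectralMatrix_eq (x y : EuclideanSpace ℝ (Fin n)) {s : ℝ} (hs : s = √(N : ℝ)) :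
    x.ofLp ⬝ᵥ spectralMatrix Y *ᵥ y.ofLp
        - (∑ i, v i ^ 4 - 3 / N) * (x ⟨0, hn⟩ * y ⟨0, hn⟩) =
      (∑ i, v i ^ 2 * normSqDev (gaussianRows Y i)) / s ^ 2 * (x ⟨0, hn⟩ * y ⟨0, hn⟩)
      + (∑ i, v i ^ 3 * inner ℝ (gaussianPart y) (gaussianRows Y i)) / s * x ⟨0, hn⟩
      + (∑ i, v i ^ 3 * inner ℝ (gaussianPart x) (gaussianRows Y i)) / s * y ⟨0, hn⟩
      + (∑ i, v i * (normSqDev (gaussianRows Y i) *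
          inner ℝ (gaussianPart y) (gaussianRows Y i))) / s ^ 3 * x ⟨0, hn⟩
      + (∑ i, v i * (normSqDev (gaussianRows Y i) *
          inner ℝ (gaussianPart x) (gaussianRows Y i))) / s ^ 3 * y ⟨0, hn⟩
      + rowForm (fun i => v i ^ 2) (∑ i, v i ^ 2) (gaussianRows Y) (gaussianPart x)
          (gaussianPart y) / s ^ 2
      + rowForm (fun i => normSqDev (gaussianRows Y i)) (2 * s ^ 2) (gaussianRows Y)
          (gaussianPart x) (gaussianPart y) / s ^ 4
      + (∑ i, v i ^ 2 - 1) / s ^ 2 * inner ℝ (gaussianPart x) (gaussianPart y) := by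
  have hs0 : 0 < s := by rw [hs]; exact Real.sqrt_pos.2 (by exact_mod_cast hN)
  have hNs : (N : ℝ) = s ^ 2 := by rw [hs, Real.sq_sqrt (by positivity)]
  rw [mulVec_spectralMatrix, dotProduct_eq_add hn]
  simp only [row_dotProduct hn hY hN, row_norm_sq_sub hn hY hN, rowForm_apply]
  rw [← hs, hNs]
  set x₀ := x ⟨0, hn⟩
  set y₀ := y ⟨0, hn⟩
  have hterm : ∀ i : Fin N, (v i ^ 2 + normSqDev (gaussianRows Y i) / s ^ 2) *
      ((v i * x₀ + inner ℝ (gaussianPart x) (gaussianRows Y i) / s) *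
        (v i * y₀ + inner ℝ (gaussianPart y) (gaussianRows Y i) / s)) =
      v i ^ 4 * (x₀ * y₀)
      + v i ^ 2 * normSqDev (gaussianRows Y i) * (1 / s ^ 2 * (x₀ * y₀))
      + v i ^ 3 * inner ℝ (gaussianPart y) (gaussianRows Y i) * (1 / s * x₀)
      + v i ^ 3 * inner ℝ (gaussianPart x) (gaussianRows Y i) * (1 / s * y₀)
      + v i * (normSqDev (gaussianRows Y i) * inner ℝ (gaussianPart y) (gaussianRows Y i))
        * (1 / s ^ 3 * x₀)
      + v i * (normSqDev (gaussianRows Y i) * inner ℝ (gaussianPart x) (gaussianRows Y i))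
        * (1 / s ^ 3 * y₀)
      + v i ^ 2 * (inner ℝ (gaussianPart x) (gaussianRows Y i) *
        inner ℝ (gaussianPart y) (gaussianRows Y i)) * (1 / s ^ 2)
      + normSqDev (gaussianRows Y i) * (inner ℝ (gaussianPart x) (gaussianRows Y i) *
        inner ℝ (gaussianPart y) (gaussianRows Y i)) * (1 / s ^ 4) := fun i => by
    field_simp
    ring
  simp only [hterm, Finset.sum_add_distrib, ← Finset.sum_mul]
  field_simp
  ring

theorem abs_form_sub_le_of_goodRows {S : Scales} (hNy : S.y = √(N : ℝ))
    (hq : S.q = |‖v‖ ^ 2 - 1|) (hG : GoodRows S v (gaussianRows Y))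
    (x y : EuclideanSpace ℝ (Fin n)) :
    |x.ofLp ⬝ᵥ spectralMatrix Y *ᵥ y.ofLp
      - (∑ i, v i ^ 4 - 3 / N) * (x ⟨0, hn⟩ * y ⟨0, hn⟩)| ≤ 10 ^ 8 * S.η * ‖x‖ * ‖y‖ := by
  have hy := S.one_le_y
  have hy0 : 0 < S.y := by linarith
  have hη := S.η_pos
  have hx0 : |x ⟨0, hn⟩| ≤ ‖x‖ := by simpa using PiLp.norm_apply_le x ⟨0, hn⟩
  have hy0' : |y ⟨0, hn⟩| ≤ ‖y‖ := by simpa using PiLp.norm_apply_le y ⟨0, hn⟩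
  have hx1 := norm_gaussianPart_le hn x
  have hy1 := norm_gaussianPart_le hn y
  have hqy : S.q / S.y ^ 2 ≤ S.η := by
    have h1 := S.η_mul_y_sq
    have := S.one_le_a; have := S.one_le_l; have := S.σ₄_nonneg
    have : 0 ≤ S.σ₄ * (S.a * S.l) + S.κ ^ 2 * (S.a ^ 2 * S.l ^ 2 + S.l ^ 4) := by positivity
    rw [div_le_iff₀ (by positivity)]; linarith
  have hv2 : ∑ i, v i ^ 2 = ‖v‖ ^ 2 := (EuclideanSpace.real_norm_sq_eq v).symm
  rw [dotProduct_spectralMatrix_eq hn hY hN x y hNy]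
  -- Seven of the eight error terms follow this pattern with constant 10⁷ and the last has constant
  -- 1, for a total below 10⁸.
  have aux : ∀ {p q A B C : ℝ}, 0 < q → |p| ≤ 10 ^ 7 * (q * S.η) * A → |B| ≤ C → 0 ≤ A →
      |p / q * B| ≤ 10 ^ 7 * S.η * (A * C) := fun {p q A B C} hq0 hp hB hA => by
    rw [abs_mul, abs_div, abs_of_pos hq0]
    calc |p| / q * |B| ≤ (10 ^ 7 * (q * S.η) * A) / q * C := by gcongr
      _ = _ := by field_simp
  have e1 := aux (A := 1) (pow_pos hy0 2) (by simpa using hG.normSqDev_le)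
    (show |x ⟨0, hn⟩ * y ⟨0, hn⟩| ≤ ‖x‖ * ‖y‖ by rw [abs_mul]; gcongr) zero_le_one
  have e2 := aux hy0 ((hG.cube_inner_le (gaussianPart y)).trans
    (mul_le_mul_of_nonneg_left hy1 (by positivity))) hx0 (norm_nonneg _)
  have e3 := aux hy0 ((hG.cube_inner_le (gaussianPart x)).trans
    (mul_le_mul_of_nonneg_left hx1 (by positivity))) hy0' (norm_nonneg _)
  have e4 := aux (pow_pos hy0 3) ((hG.normSqDev_inner_le (gaussianPart y)).trans
    (mul_le_mul_of_nonneg_left hy1 (by positivity))) hx0 (norm_nonneg _)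
  have e5 := aux (pow_pos hy0 3) ((hG.normSqDev_inner_le (gaussianPart x)).trans
    (mul_le_mul_of_nonneg_left hx1 (by positivity))) hy0' (norm_nonneg _)
  have hxy : ‖gaussianPart x‖ * ‖gaussianPart y‖ ≤ ‖x‖ * ‖y‖ := by gcongr
  have e6 := aux (A := ‖x‖ * ‖y‖) (B := 1) (C := 1) (pow_pos hy0 2)
    ((hG.sq_form_le (gaussianPart x) (gaussianPart y)).trans
      (by rw [mul_assoc _ ‖gaussianPart x‖]; exact mul_le_mul_of_nonneg_left hxy (by positivity)))
    (by simp) (by positivity)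
  have e7 := aux (A := ‖x‖ * ‖y‖) (B := 1) (C := 1) (pow_pos hy0 4)
    ((hG.normSqDev_form_le (gaussianPart x) (gaussianPart y)).trans
      (by rw [mul_assoc _ ‖gaussianPart x‖]; exact mul_le_mul_of_nonneg_left hxy (by positivity)))
    (by simp) (by positivity)
  have e8 : |(∑ i, v i ^ 2 - 1) / S.y ^ 2 * inner ℝ (gaussianPart x) (gaussianPart y)|
      ≤ S.η * (‖x‖ * ‖y‖) := by
    rw [abs_mul, abs_div, abs_of_pos (pow_pos hy0 2), hv2, ← hq]
    gcongr
    exact (abs_real_inner_le_norm _ _).trans hxy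
  rw [mul_one] at e6 e7
  have h0 : 0 ≤ S.η * (‖x‖ * ‖y‖) := by positivity
  refine (abs_add_le _ _).trans ((add_le_add ((abs_add_le _ _).trans (add_le_add
    ((abs_add_le _ _).trans (add_le_add ((abs_add_le _ _).trans (add_le_add
    ((abs_add_le _ _).trans (add_le_add ((abs_add_le _ _).trans (add_le_add
    ((abs_add_le _ _).trans (add_le_add e1 e2)) e3)) e4)) e5)) e6)) e7)) e8).trans ?_)
  nlinarith

theorem norm_estimator_le_of_goodRows {S : Scales} (hNy : S.y = √(N : ℝ))
    (hG : GoodRows S v (gaussianRows Y)) (x : EuclideanSpace ℝ (Fin n)) :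
    ‖estimator Y x‖ ≤ 100 * (‖v‖ + 1) * ‖x‖ := by
  have hy0 : 0 < S.y := by linarith [S.one_le_y]
  have h1 : estimator Y x = x ⟨0, hn⟩ • v + (1 / S.y) • (WithLp.toLp 2 fun i =>
      inner ℝ (gaussianPart x) (gaussianRows Y i) : EuclideanSpace ℝ (Fin N)) := by
    ext i
    simp only [estimator, Matrix.mulVec, row_dotProduct hn hY hN, PiLp.add_apply, PiLp.smul_apply,
      smul_eq_mul, hNy]
    ring
  have h2 : ‖(WithLp.toLp 2 fun i => inner ℝ (gaussianPart x) (gaussianRows Y i) :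
      EuclideanSpace ℝ (Fin N))‖ ≤ 100 * S.y * ‖x‖ := by
    refine abs_le_of_sq_le_sq' ?_ (by positivity) |>.2
    rw [EuclideanSpace.real_norm_sq_eq]
    refine (hG.sum_sq_le (gaussianPart x)).trans ?_
    have := norm_gaussianPart_le hn x
    calc 10 ^ 4 * S.y ^ 2 * ‖gaussianPart x‖ ^ 2 ≤ 10 ^ 4 * S.y ^ 2 * ‖x‖ ^ 2 := by gcongr
      _ = _ := by ring
  have hx0 : |x ⟨0, hn⟩| ≤ ‖x‖ := by simpa using PiLp.norm_apply_le x ⟨0, hn⟩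
  rw [h1]
  refine (norm_add_le _ _).trans ?_
  rw [norm_smul, norm_smul, Real.norm_eq_abs, Real.norm_eq_abs,
    abs_of_pos (by positivity : 0 < 1 / S.y)]
  have h3 : |x ⟨0, hn⟩| * ‖v‖ ≤ ‖x‖ * ‖v‖ := by gcongr
  have h4 := mul_le_mul_of_nonneg_left h2 (by positivity : 0 ≤ 1 / S.y)
  have h5 : 1 / S.y * (100 * S.y * ‖x‖) = 100 * ‖x‖ := by field_simp
  nlinarith [norm_nonneg x, norm_nonneg v, mul_nonneg (norm_nonneg x) (norm_nonneg v)]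

theorem spectralErrorLE_of_goodRows {S : Scales} (hNy : S.y = √(N : ℝ))
    (hq : S.q = |‖v‖ ^ 2 - 1|) (hG : GoodRows S v (gaussianRows Y))
    (hθ : ∑ i, v i ^ 4 - 3 / (N : ℝ) ≠ 0) :
    SpectralErrorLE Y v
        (100 * (‖v‖ + 1) * (4 * (10 ^ 8 * S.η) / |∑ i, v i ^ 4 - 3 / (N : ℝ)|)) ∧
      SpectralErrorLE Y v (100 * (‖v‖ + 1) * 2) :=
  spectralErrorLE_of_form hY hθ (abs_form_sub_le_of_goodRows hn hY hN hNy hq hG)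
    (norm_estimator_le_of_goodRows hn hY hN hNy hG) (by positivity)

end Rows

/-! ### The law of the Gaussian rows -/

theorem map_gaussianRows {Ω : Type*} [MeasurableSpace Ω] {P : Measure Ω} [IsProbabilityMeasure P]
    {N n : ℕ} (hN : 0 < N) {v : EuclideanSpace ℝ (Fin N)} {Y : Ω → Matrix (Fin N) (Fin n) ℝ}
    (hY : IsGaussianBasis P v Y) :
    AEMeasurable (fun ω => gaussianRows (Y ω)) P ∧
      P.map (fun ω => gaussianRows (Y ω)) = Measure.pi fun _ => stdGaussian _ := by
  have hN' : (0 : ℝ) < N := by exact_mod_cast hN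
  have hlaw : ∀ p : Fin N × {j : Fin n // (j : ℕ) ≠ 0},
      HasLaw (fun ω => √(N : ℝ) * Y ω p.1 p.2) (gaussianReal 0 1) P := fun p => by
    have h := gaussianReal_const_mul (hY.law_entry p.1 p.2 p.2.2) (√(N : ℝ))
    convert h using 2
    · simp
    · ext
      simp [Real.sq_sqrt hN'.le, hN'.ne']
  have hind : iIndepFun (fun (p : Fin N × {j : Fin n // (j : ℕ) ≠ 0}) ω =>
      √(N : ℝ) * Y ω p.1 p.2) P :=
    hY.indep.comp (fun _ x => √(N : ℝ) * x) fun _ => by fun_prop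
  have hpi := hind.hasLaw_pi hlaw
  have hcurry : HasLaw (fun ω (i : Fin N) (j : {j : Fin n // (j : ℕ) ≠ 0}) =>
      √(N : ℝ) * Y ω i j)
      (Measure.pi fun _ : Fin N => Measure.pi fun _ : {j : Fin n // (j : ℕ) ≠ 0} =>
        gaussianReal 0 1) P := by
    refine ⟨?_, ?_⟩
    · exact aemeasurable_pi_iff.2 fun i => aemeasurable_pi_iff.2 fun j =>
        (hlaw (i, j)).aemeasurable
    -- Currying turns the product law over all entries into a product over rows of product laws.
    · have h1 := Measure.infinitePi_map_curry (ι := Fin N) (κ := {j : Fin n // (j : ℕ) ≠ 0})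
        (X := ℝ) (fun _ _ => gaussianReal 0 1)
      simp only [Measure.infinitePi_eq_pi] at h1
      rw [← h1, ← hpi.map_eq, AEMeasurable.map_map_of_aemeasurable
        (MeasurableEquiv.measurable _).aemeasurable hpi.aemeasurable]
      rfl
  have hm : AEMeasurable (fun ω => gaussianRows (Y ω)) P := by
    have h2 : Measurable fun (h : Fin N → {j : Fin n // (j : ℕ) ≠ 0} → ℝ) i =>
      (WithLp.toLp 2 (h i) : EuclideanSpace ℝ {j : Fin n // (j : ℕ) ≠ 0}) := by fun_prop
    exact h2.comp_aemeasurable hcurry.aemeasurable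
  refine ⟨hm, ?_⟩
  have h3 := Measure.pi_map_pi (μ := fun _ : Fin N => Measure.pi
    fun _ : {j : Fin n // (j : ℕ) ≠ 0} => gaussianReal 0 1)
    (f := fun _ => (WithLp.toLp 2 : _ → EuclideanSpace ℝ {j : Fin n // (j : ℕ) ≠ 0}))
    (fun _ => by fun_prop)
  simp only [map_pi_eq_stdGaussian] at h3
  rw [← h3, ← hcurry.map_eq, AEMeasurable.map_map_of_aemeasurable
    (Measurable.aemeasurable (by fun_prop)) hcurry.aemeasurable]
  rfl

/-! ### The norms of the planted vector -/

section Norms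

variable {N : ℕ} (v : EuclideanSpace ℝ (Fin N))

theorem ellNorm_pow_eq {k : ℕ} (hk : 0 < k) : ellNorm k v ^ k = ∑ i, |v i| ^ k := by
  have hk' : (0 : ℝ) < k := by exact_mod_cast hk
  rw [ellNorm, PiLp.norm_eq_sum (by simpa using hk)]
  simp only [ENNReal.toReal_natCast, Real.rpow_natCast, Real.norm_eq_abs]
  rw [one_div, Real.rpow_inv_natCast_pow (by positivity) hk.ne']

theorem ellNorm_four_pow_four : ellNorm 4 v ^ 4 = ∑ i, v i ^ 4 := by
  have := ellNorm_pow_eq v (k := 4) (by norm_num)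
  simpa [Even.pow_abs (by decide : Even 4)] using this

theorem ellNorm_six_pow_six : ellNorm 6 v ^ 6 = ∑ i, v i ^ 6 := by
  have := ellNorm_pow_eq v (k := 6) (by norm_num)
  simpa [Even.pow_abs (by decide : Even 6)] using this

theorem abs_le_ellNorm_top (i : Fin N) : |v i| ≤ ellNorm ∞ v :=
  PiLp.norm_apply_le (WithLp.toLp ∞ (WithLp.ofLp v)) i

theorem ellNorm_nonneg (p : ℝ≥0∞) [Fact (1 ≤ p)] : 0 ≤ ellNorm p v := norm_nonneg _

end Norms


/-! ### The probability of a large spectral error -/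

theorem rpow_three_halves {x : ℝ} (hx : 0 ≤ x) : x ^ (3 / 2 : ℝ) = √x ^ 3 := by
  rw [Real.sqrt_eq_rpow, ← Real.rpow_natCast, ← Real.rpow_mul hx]
  norm_num

section Scales

variable {N n : ℕ} (hn : 1 ≤ n) (hnN : n ≤ N) (v : EuclideanSpace ℝ (Fin N)) {δ : ℝ}
  (hL : 1 ≤ Real.log (N / δ)) (hL7 : Real.log (N / δ) ^ 7 ≤ N)

/-- The scales attached to a planted vector and a failure probability. -/
noncomputable def scales : Scales where
  a := √n
  l := √(Real.log (N / δ))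
  y := √N
  r := ‖v‖
  σ₄ := ellNorm 4 v ^ 2
  σ₆ := ellNorm 6 v ^ 3
  κ := ellNorm ∞ v
  q := |‖v‖ ^ 2 - 1|
  -- Left open so that `η_eq := rfl` determines it.
  η := _
  one_le_a := Real.one_le_sqrt.2 (by exact_mod_cast hn)
  a_le_y := Real.sqrt_le_sqrt (by exact_mod_cast hnN)
  one_le_l := Real.one_le_sqrt.2 hL
  l_pow_le := by
    refine Real.le_sqrt_of_sq_le ?_
    rw [← pow_mul, mul_comm, pow_mul, Real.sq_sqrt (by linarith)]
    exact hL7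
  r_nonneg := norm_nonneg v
  σ₄_nonneg := sq_nonneg _
  σ₆_nonneg :=
    have : Fact ((1 : ℝ≥0∞) ≤ 6) := ⟨by norm_num⟩
    pow_nonneg (ellNorm_nonneg v 6) 3
  κ_nonneg := ellNorm_nonneg v ∞
  q_nonneg := abs_nonneg _
  η_eq := rfl

theorem scales_η : (scales hn hnN v hL hL7).η = eta 1 n v δ := by
  have hL0 : 0 ≤ Real.log (N / δ) := by linarith
  have hN0 : (0 : ℝ) ≤ N := by positivity
  have hn0 : (0 : ℝ) ≤ n := by positivity
  rw [Scales.η_eq, eta, rpow_three_halves hN0, rpow_three_halves (by positivity),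
    Real.sqrt_mul hn0, one_mul]
  simp only [scales]
  have e1 : √(n : ℝ) ^ 2 = n := Real.sq_sqrt hn0
  have e2 : √(N : ℝ) ^ 2 = N := Real.sq_sqrt hN0
  have e3 : √(Real.log (N / δ)) ^ 2 = Real.log (N / δ) := Real.sq_sqrt hL0
  have e4 : √(N : ℝ) ^ 4 = (N : ℝ) ^ 2 := by rw [← e2]; ring_nf; rw [e2]
  have e5 : √(Real.log (N / δ)) ^ 4 = Real.log (N / δ) ^ 2 := by
    rw [show (4 : ℕ) = 2 * 2 by norm_num, pow_mul, e3]
  rw [e1, e2, e3, e4, e5]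
  ring

/-- With l² = log(N/δ) the factor e^(-3l²) equals (δ/N)³, and (2N + 12)(δ/N)³ ≤ δ once N ≥ 3. The
constant is 4·10¹⁰ = 100 · 4 · 10⁸. -/
theorem measureReal_not_spectralErrorLE_le (hN3 : 3 ≤ N) (hδ0 : 0 < δ) (hδ1 : δ < 1)
    (hθ : ellNorm 4 v ^ 4 - 3 / (N : ℝ) ≠ 0) {Ω : Type*} [MeasurableSpace Ω] {P : Measure Ω}
    [IsProbabilityMeasure P] {Y : Ω → Matrix (Fin N) (Fin n) ℝ} (hY : IsGaussianBasis P v Y) :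
    P.real {ω | ¬ (SpectralErrorLE (Y ω) v (4 * 10 ^ 10 * (scales hn hnN v hL hL7).η *
        ((‖v‖ + 1) / |ellNorm 4 v ^ 4 - 3 / (N : ℝ)|)) ∧
      SpectralErrorLE (Y ω) v (100 * (‖v‖ + 1) * 2))} ≤ δ := by
  set S := scales hn hnN v hL hL7 with hS
  have hN0 : 0 < N := by omega
  have hN0' : (0 : ℝ) < N := by exact_mod_cast hN0
  have hN3' : (3 : ℝ) ≤ N := by exact_mod_cast hN3
  have hNδ : 0 < (N : ℝ) / δ := by positivity
  have hl2 : S.l ^ 2 = Real.log (N / δ) := Real.sq_sqrt (by linarith)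
  have hy2 : S.y ^ 2 = N := Real.sq_sqrt hN0'.le
  have ha2 : S.a ^ 2 = n := Real.sq_sqrt (by positivity)
  obtain ⟨hm, hmap⟩ := map_gaussianRows hN0 hY
  have key := measureReal_not_goodRows_le
    (E := EuclideanSpace ℝ {j : Fin n // (j : ℕ) ≠ 0}) (ι := Fin N) (S := S) (n := n) hn ha2.symm
    (by have := finrank_gaussianRows hn; omega) (by rw [hy2, Fintype.card_fin])
    (by
      rw [hy2, hl2, Real.exp_log hNδ, le_div_iff₀ hδ0]
      nlinarith)
    (v := v) (EuclideanSpace.real_norm_sq_eq v).ge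
    (by
      rw [← ellNorm_four_pow_four]
      exact le_of_eq (by simp only [hS, scales]; ring))
    (by
      rw [← ellNorm_six_pow_six]
      exact le_of_eq (by simp only [hS, scales]; ring))
    (fun i => abs_le_ellNorm_top v i)
  have hsub : {ω | ¬ (SpectralErrorLE (Y ω) v (4 * 10 ^ 10 * S.η *
        ((‖v‖ + 1) / |ellNorm 4 v ^ 4 - 3 / (N : ℝ)|)) ∧
      SpectralErrorLE (Y ω) v (100 * (‖v‖ + 1) * 2))}
      ⊆ (fun ω => gaussianRows (Y ω)) ⁻¹' {h | ¬ GoodRows S v h} := by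
    intro ω hω
    contrapose! hω
    have hgood : GoodRows S v (gaussianRows (Y ω)) := by
      simpa only [Set.mem_preimage, Set.mem_ofPred_eq, not_not] using hω
    rw [ellNorm_four_pow_four] at hθ ⊢
    have h := spectralErrorLE_of_goodRows hn (fun i => hY.first_col ω i ⟨0, hn⟩ rfl) hN0
      (S := S) rfl rfl hgood hθ
    refine fun himp => himp ?_ h.2
    convert h.1 using 1
    ring
  have hprob : P.real ((fun ω => gaussianRows (Y ω)) ⁻¹' {h | ¬ GoodRows S v h})
      ≤ (2 * S.y ^ 2 + 12) * Real.exp (-(3 * S.l ^ 2)) := by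
    refine le_trans ?_ key
    rw [← hmap]
    have := Measure.isProbabilityMeasure_map hm
    -- The bad event is not known to be measurable; the one-sided comparison with the image measure
    -- needs no measurability.
    exact ENNReal.toReal_mono (measure_ne_top _ _) (Measure.le_map_apply hm _)
  refine (measureReal_mono hsub).trans (hprob.trans ?_)
  have hexp : Real.exp (-(3 * S.l ^ 2)) = (δ / N) ^ 3 := by
    rw [hl2, Real.exp_neg, show (3 : ℝ) * Real.log (N / δ) = (3 : ℕ) * Real.log (N / δ) by norm_num,
      Real.exp_nat_mul, Real.exp_log hNδ, ← inv_pow, inv_div]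
  rw [hexp, hy2, div_pow, mul_div_assoc', div_le_iff₀ (by positivity)]
  have h1 : 2 * (N : ℝ) + 12 ≤ (N : ℝ) ^ 3 := by nlinarith [mul_self_nonneg ((N : ℝ) - 3)]
  have h2 : δ ^ 3 ≤ δ := by nlinarith [mul_pos hδ0 hδ0]
  calc (2 * (N : ℝ) + 12) * δ ^ 3 ≤ (N : ℝ) ^ 3 * δ := by gcongr
    _ = _ := by ring

end Scales

theorem SpectralErrorLE.mono {N n : ℕ} {Y : Matrix (Fin N) (Fin n) ℝ}
    {v : EuclideanSpace ℝ (Fin N)} {r r' : ℝ} (h : SpectralErrorLE Y v r) (hr : r ≤ r') :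
    SpectralErrorLE Y v r' := fun Q hQ u hu =>
  (h Q hQ u hu).imp (fun h => h.trans hr) (fun h => h.trans hr)

/-! ### Unit vectors -/

/-- For a unit vector, either the bound of the theorem is trivial or `η / ‖v‖₄⁴` is of the order of
the simplified bound. -/
theorem Scales.η_le_of_unit (S : Scales) (hr : S.r = 1) (hq : S.q = 0) (hκ : 1 ≤ S.κ * S.y)
    (hσ : 0 < S.σ₄) (h6 : S.σ₆ ≤ S.κ * S.σ₄) (ht : S.κ * S.a / (S.σ₄ * S.y) ≤ 1) :
    S.η ≤ 5 * S.l ^ 4 * S.σ₄ ^ 2 *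
      (S.a ^ 2 / (S.σ₄ ^ 2 * S.y ^ 3) + S.κ * S.a / (S.σ₄ * S.y)) := by
  have ha := S.one_le_a
  have hl := S.one_le_l
  have hy := S.one_le_y
  have hκ0 := S.κ_nonneg
  have hl1 : S.l ≤ S.l ^ 4 := le_self_pow₀ hl (by norm_num)
  have hl3 : S.l ^ 3 ≤ S.l ^ 4 := pow_le_pow_right₀ hl (by norm_num)
  set p := S.a ^ 2 / (S.σ₄ ^ 2 * S.y ^ 3) with hp
  set t := S.κ * S.a / (S.σ₄ * S.y) with htdef
  have hp0 : 0 ≤ p := by positivity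
  have ht0 : 0 ≤ t := by positivity
  -- p and t are the two terms of the simplified bound. The five summands of η contribute 2p, t, 2t,
  -- 2t and p, up to the common factor σ₄² l⁴; the second uses 1 ≤ κ y, the fourth t ≤ 1 and the
  -- fifth a ≤ y.
  have e1 : (1 + 1) * (S.a ^ 2 * S.l / S.y ^ 3) ≤ S.σ₄ ^ 2 * (2 * S.l ^ 4 * p) := by
    calc (1 + 1) * (S.a ^ 2 * S.l / S.y ^ 3) = S.σ₄ ^ 2 * (2 * S.l * p) := by
          rw [hp]; field_simp; norm_num
      _ ≤ _ := by gcongr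
  have e2 : S.σ₄ * (S.a * S.l / S.y ^ 2) ≤ S.σ₄ ^ 2 * (S.l ^ 4 * t) := by
    calc S.σ₄ * (S.a * S.l / S.y ^ 2) ≤ S.σ₄ * (S.a * S.l / S.y ^ 2) * (S.κ * S.y) :=
          le_mul_of_one_le_right (by positivity) hκ
      _ = S.σ₄ ^ 2 * (S.l * t) := by rw [htdef]; field_simp
      _ ≤ _ := by gcongr
  have e3 : S.σ₆ * ((S.a + S.l) / S.y) ≤ S.σ₄ ^ 2 * (2 * S.l ^ 4 * t) := by
    calc S.σ₆ * ((S.a + S.l) / S.y) ≤ S.κ * S.σ₄ * ((2 * S.a * S.l) / S.y) := by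
          gcongr; nlinarith
      _ = S.σ₄ ^ 2 * (2 * S.l * t) := by rw [htdef]; field_simp
      _ ≤ _ := by gcongr
  have e4 : S.κ ^ 2 * ((S.a ^ 2 * S.l ^ 2 + S.l ^ 4) / S.y ^ 2) ≤ S.σ₄ ^ 2 * (2 * S.l ^ 4 * t) := by
    calc S.κ ^ 2 * ((S.a ^ 2 * S.l ^ 2 + S.l ^ 4) / S.y ^ 2)
        ≤ S.κ ^ 2 * ((S.a ^ 2 * S.l ^ 4 + S.a ^ 2 * S.l ^ 4) / S.y ^ 2) := by
          have : S.l ^ 2 ≤ S.l ^ 4 := pow_le_pow_right₀ hl (by norm_num)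
          have : S.l ^ 4 ≤ S.a ^ 2 * S.l ^ 4 :=
            le_mul_of_one_le_left (by positivity) (one_le_pow₀ ha)
          gcongr
      _ = S.σ₄ ^ 2 * (2 * S.l ^ 4 * t * t) := by rw [htdef]; field_simp; ring
      _ ≤ S.σ₄ ^ 2 * (2 * S.l ^ 4 * t * 1) := by gcongr
      _ = _ := by rw [mul_one]
  have e5 : (S.a * S.l) ^ 3 / S.y ^ 4 ≤ S.σ₄ ^ 2 * (S.l ^ 4 * p) := by
    calc (S.a * S.l) ^ 3 / S.y ^ 4 = S.σ₄ ^ 2 * (S.l ^ 3 * p) * (S.a / S.y) := by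
          rw [hp]; field_simp
      _ ≤ S.σ₄ ^ 2 * (S.l ^ 3 * p) * 1 := by
          gcongr; exact (div_le_one (by linarith)).2 S.a_le_y
      _ ≤ _ := by rw [mul_one]; gcongr
  rw [S.η_eq, hr, hq, zero_div, add_zero]
  have : 0 ≤ S.σ₄ ^ 2 * (S.l ^ 4 * p) := by positivity
  linarith

/-- If t = κ a/(σ₄ y) exceeds 1, the claimed bound is above the trivial error bound 400. Otherwise η
is at most 5 l⁴ σ₄² (p + t) with l⁴ ≤ 4 log⁴ N, and the fifth power of log N absorbs the numerical
constants. -/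
theorem unit_bound {N n : ℕ} (hn : 1 ≤ n) (hnN : n ≤ N) (v : EuclideanSpace ℝ (Fin N)) {δ : ℝ}
    (hL : 1 ≤ Real.log (N / δ)) (hL7 : Real.log (N / δ) ^ 7 ≤ N) (hv : ‖v‖ = 1) {c : ℝ}
    (hc : 0 < c) (hcθ : c / N ≤ |ellNorm 4 v ^ 4 - 3 / (N : ℝ)|)
    (hlog : Real.log (N / δ) ≤ 2 * Real.log N ^ 2) (hbig : 10 ^ 14 ≤ Real.log N)
    {Y : Matrix (Fin N) (Fin n) ℝ}
    (h : SpectralErrorLE Y v (4 * 10 ^ 10 * (scales hn hnN v hL hL7).η *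
        ((‖v‖ + 1) / |ellNorm 4 v ^ 4 - 3 / (N : ℝ)|)) ∧
      SpectralErrorLE Y v (100 * (‖v‖ + 1) * 2)) :
    SpectralErrorLE Y v ((1 + 1 / c) * Real.log N ^ (5 : ℝ) *
            (1 / ellNorm 4 v ^ 4 * (n / (N : ℝ) ^ (3 / 2 : ℝ))
              + ellNorm ∞ v / ellNorm 4 v ^ 2 * √(n / N))) := by
  set S := scales hn hnN v hL hL7 with hS
  have hN0 : 0 < N := by omega
  have hN0' : (0 : ℝ) < N := by exact_mod_cast hN0
  have hy0 : 0 < S.y := by linarith [S.one_le_y]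
  have ha0 : 0 < S.a := by linarith [S.one_le_a]
  have hl2 : S.l ^ 2 = Real.log (N / δ) := Real.sq_sqrt (by linarith)
  have hy2 : S.y ^ 2 = N := Real.sq_sqrt hN0'.le
  have ha2 : S.a ^ 2 = n := Real.sq_sqrt (by positivity)
  have hκ0 := S.κ_nonneg
  have hσ4 : S.σ₄ ^ 2 = ∑ i, v i ^ 4 := by
    rw [← ellNorm_four_pow_four]; simp only [hS, scales]; ring
  have hσ4' : ellNorm 4 v ^ 4 = S.σ₄ ^ 2 := by rw [hσ4, ellNorm_four_pow_four]
  have hσ6 : S.σ₆ ^ 2 = ∑ i, v i ^ 6 := by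
    rw [← ellNorm_six_pow_six]; simp only [hS, scales]; ring
  have hv2 : ∑ i, v i ^ 2 = 1 := by
    rw [← EuclideanSpace.real_norm_sq_eq, hv, one_pow]
  have hκ : ∀ i, v i ^ 2 ≤ S.κ ^ 2 := fun i => by
    rw [← sq_abs]; gcongr; exact abs_le_ellNorm_top v i
  have hκy : 1 ≤ S.κ * S.y := by
    have h1 : 1 ≤ (S.κ * S.y) ^ 2 := by
      rw [mul_pow, hy2, ← hv2, mul_comm]
      refine (Finset.sum_le_sum fun i _ => hκ i).trans_eq ?_
      simp
    exact (one_le_sq_iff₀ (by positivity)).1 h1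
  have hσ0 : 0 < S.σ₄ := by
    rcases S.σ₄_nonneg.eq_or_lt with h0 | h0
    -- Cauchy–Schwarz: 1 = (∑ vᵢ²)² ≤ N ∑ vᵢ⁴, so ‖v‖₄ cannot vanish.
    · have h1 := sq_sum_le_card_mul_sum_sq (s := Finset.univ) (f := fun i => v i ^ 2)
      simp only [← pow_mul] at h1
      rw [hv2, ← hσ4, ← h0] at h1
      norm_num at h1
    · exact h0
  have h6 : S.σ₆ ≤ S.κ * S.σ₄ := by
    refine abs_le_of_sq_le_sq' ?_ (mul_nonneg hκ0 hσ0.le) |>.2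
    rw [mul_pow, hσ6, hσ4, Finset.mul_sum]
    refine Finset.sum_le_sum fun i _ => ?_
    calc v i ^ 6 = v i ^ 2 * v i ^ 4 := by ring
      _ ≤ _ := mul_le_mul_of_nonneg_right (hκ i) (by positivity)
  set Λ := Real.log N with hΛ
  have hΛ0 : 0 < Λ := by linarith
  have hΛ4 : 1 ≤ Λ ^ 4 := one_le_pow₀ (by linarith)
  set p := S.a ^ 2 / (S.σ₄ ^ 2 * S.y ^ 3) with hp
  set t := S.κ * S.a / (S.σ₄ * S.y) with ht
  have hp0 : 0 ≤ p := by positivity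
  have ht0 : 0 ≤ t := by positivity
  have hbound : 1 / ellNorm 4 v ^ 4 * (n / (N : ℝ) ^ (3 / 2 : ℝ))
      + ellNorm ∞ v / ellNorm 4 v ^ 2 * √(n / N) = p + t := by
    rw [hσ4', rpow_three_halves hN0'.le, Real.sqrt_div (by positivity), hp, ht, ha2]
    simp only [hS, scales]
    field_simp
  rw [hbound, show (5 : ℝ) = (5 : ℕ) by norm_num, Real.rpow_natCast]
  have hc1 : 0 < 1 / c := by positivity
  rcases le_or_gt t 1 with ht1 | ht1
  · refine h.1.mono ?_
    have hη := S.η_le_of_unit hv (by simp [hS, scales, hv]) hκy hσ0 h6 ht1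
    rw [hσ4'] at hcθ ⊢
    set θ := |S.σ₄ ^ 2 - 3 / (N : ℝ)| with hθ
    have hθ0 : 0 < θ := lt_of_lt_of_le (by positivity) hcθ
    -- The gap hypothesis gives 1/N ≤ θ/c, so ‖v‖₄⁴ ≤ θ + 3/N is comparable to θ.
    have hxθ : S.σ₄ ^ 2 ≤ 3 * (1 + 1 / c) * θ := by
      have h1 : S.σ₄ ^ 2 ≤ θ + 3 / N := by
        have := le_abs_self (S.σ₄ ^ 2 - 3 / (N : ℝ)); linarith
      have h2 : 3 / (N : ℝ) ≤ 3 * (1 / c * θ) := by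
        have := mul_le_mul_of_nonneg_left hcθ hc1.le
        have h3 : 1 / c * (c / N) = 1 / (N : ℝ) := by field_simp
        rw [h3] at this
        linarith [show 3 / (N : ℝ) = 3 * (1 / N) by ring]
      nlinarith
    have hl4 : S.l ^ 4 ≤ 4 * Λ ^ 4 := by
      calc S.l ^ 4 = (S.l ^ 2) ^ 2 := by ring
        _ ≤ (2 * Λ ^ 2) ^ 2 := by rw [hl2]; gcongr
        _ = _ := by ring
    rw [hv, mul_div_assoc', div_le_iff₀ hθ0]
    calc 4 * 10 ^ 10 * S.η * (1 + 1)
        ≤ 4 * 10 ^ 10 * (5 * (4 * Λ ^ 4) * (3 * (1 + 1 / c) * θ) * (p + t)) * (1 + 1) := by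
          gcongr
          refine hη.trans ?_
          gcongr
      _ = (48 * 10 ^ 11) * ((1 + 1 / c) * Λ ^ 4 * (p + t) * θ) := by ring
      _ ≤ Λ * ((1 + 1 / c) * Λ ^ 4 * (p + t) * θ) := by
          gcongr
          linarith
      _ = _ := by ring
  · refine h.2.mono ?_
    rw [hv]
    have h5 : 400 ≤ Λ ^ 5 := by
      calc (400 : ℝ) ≤ Λ := by linarith
        _ ≤ Λ ^ 5 := le_self_pow₀ (by linarith) (by norm_num)
    calc (100 : ℝ) * (1 + 1) * 2 = 1 * 400 * 1 := by norm_num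
      _ ≤ (1 + 1 / c) * Λ ^ 5 * (p + t) := by
        gcongr <;> linarith

end PlantedVector

/-! ### Choice of N₀, δ and w, and the two statements -/

open PlantedVector in
theorem theorem2p1 :
    ∃ N₀ : ℕ,
    -- general form, with explicit logarithms
    (∃ C₀ > (0 : ℝ), ∃ C > (0 : ℝ),
      ∀ (N n : ℕ), N₀ ≤ N → 1 ≤ n → n ≤ N →
      ∀ (v : EuclideanSpace ℝ (Fin N)), ellNorm 4 v ^ 4 ≠ 3 / (N : ℝ) →
      ∀ δ : ℝ, 0 < δ → δ < 1 → Real.log (N / δ) ^ 7 ≤ (N : ℝ) →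
      ∀ (Ω : Type*) [MeasurableSpace Ω] (P : Measure Ω) [IsProbabilityMeasure P]
        (Y : Ω → Matrix (Fin N) (Fin n) ℝ), IsGaussianBasis P v Y →
        P.real {ω | ¬ SpectralErrorLE (Y ω) v
          (C * eta C₀ n v δ * ((‖v‖ + 1) / |ellNorm 4 v ^ 4 - 3 / (N : ℝ)|))} ≤ δ) ∧
    -- simplified form for a unit vector
    (∃ A > (0 : ℝ), ∃ w : ℕ → ℝ, Tendsto w atTop atTop ∧
      ∀ c : ℝ, 0 < c → ∀ (N n : ℕ), N₀ ≤ N → 1 ≤ n → n ≤ N →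
      ∀ (v : EuclideanSpace ℝ (Fin N)), ‖v‖ = 1 → c / N ≤ |ellNorm 4 v ^ 4 - 3 / (N : ℝ)| →
      ∀ (Ω : Type*) [MeasurableSpace Ω] (P : Measure Ω) [IsProbabilityMeasure P]
        (Y : Ω → Matrix (Fin N) (Fin n) ℝ), IsGaussianBasis P v Y →
        P.real {ω | ¬ SpectralErrorLE (Y ω) v
          ((1 + 1 / c) * Real.log N ^ A *
            (1 / ellNorm 4 v ^ 4 * (n / (N : ℝ) ^ (3 / 2 : ℝ))
              + ellNorm ∞ v / ellNorm 4 v ^ 2 * √(n / N)))} ≤ (N : ℝ) ^ (-w N)) := by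
  have hlogN : Tendsto (fun N : ℕ => Real.log N) atTop atTop :=
    Real.tendsto_log_atTop.comp tendsto_natCast_atTop_atTop
  -- The first condition absorbs the numerical constants into one logarithm. The second yields
  -- log⁷(N/δ) ≤ N when log(N/δ) ≤ 2 log² N, because (2 log² N)⁷ = 128 log¹⁴ N.
  have hev : ∀ᶠ N : ℕ in atTop, 10 ^ 14 ≤ Real.log N ∧ 128 * Real.log N ^ 14 ≤ N := by
    have h1 := (Real.isLittleO_pow_log_id_atTop (n := 14)).bound (by norm_num : (0 : ℝ) < 1 / 128)
    have h2 := tendsto_natCast_atTop_atTop.eventually h1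
    filter_upwards [hlogN.eventually_ge_atTop (10 ^ 14), h2] with N h3 h4
    refine ⟨h3, ?_⟩
    simp only [id, Real.norm_eq_abs, Nat.abs_cast] at h4
    linarith [le_abs_self (Real.log N ^ 14)]
  obtain ⟨N₁, hN₁⟩ := eventually_atTop.1 hev
  refine ⟨max 3 N₁, ⟨1, one_pos, 4 * 10 ^ 10, by norm_num, ?_⟩,
    ⟨5, by norm_num, fun N => Real.log N, hlogN, ?_⟩⟩
  · intro N n hN hn hnN v hv δ hδ0 hδ1 hL7 Ω _ P _ Y hY
    have hN0 : (0 : ℝ) < N := by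
      have := le_of_max_le_left hN
      exact_mod_cast (by omega : 0 < N)
    have hL : 1 ≤ Real.log (N / δ) := by
      have h1 := (hN₁ N (le_of_max_le_right hN)).1
      have h2 : Real.log N ≤ Real.log (N / δ) :=
        Real.log_le_log hN0 ((le_div_iff₀ hδ0).2 (by nlinarith))
      linarith
    have h := measureReal_not_spectralErrorLE_le hn hnN v hL hL7 (le_of_max_le_left hN) hδ0 hδ1
      (sub_ne_zero.2 hv) hY
    refine le_trans (measureReal_mono (Set.compl_subset_compl.2 fun ω hgood => ?_)) h
    rw [← scales_η hn hnN v hL hL7]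
    exact (show _ ∧ _ from hgood).1
  · intro c hc N n hN hn hnN v hv hcθ Ω _ P _ Y hY
    obtain ⟨hbig, hpow⟩ := hN₁ N (le_of_max_le_right hN)
    have hN0 : (0 : ℝ) < N := by
      have := le_of_max_le_left hN
      exact_mod_cast (by omega : 0 < N)
    have hN1 : (1 : ℝ) < N := by
      have := le_of_max_le_left hN
      exact_mod_cast (by omega : 1 < N)
    -- This choice means w(N) = log N, and log(N/δ) = log N + log² N is still polylogarithmic.
    set δ : ℝ := (N : ℝ) ^ (-Real.log N) with hδ
    have hδ0 : 0 < δ := Real.rpow_pos_of_pos hN0 _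
    have hδ1 : δ < 1 := Real.rpow_lt_one_of_one_lt_of_neg hN1 (by linarith)
    have hlog : Real.log (N / δ) = Real.log N + Real.log N ^ 2 := by
      rw [Real.log_div hN0.ne' hδ0.ne', hδ, Real.log_rpow hN0]; ring
    have hlog2 : Real.log (N / δ) ≤ 2 * Real.log N ^ 2 := by rw [hlog]; nlinarith
    have hL : 1 ≤ Real.log (N / δ) := by rw [hlog]; nlinarith
    have hL7 : Real.log (N / δ) ^ 7 ≤ N := by
      calc Real.log (N / δ) ^ 7 ≤ (2 * Real.log N ^ 2) ^ 7 := by gcongr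
        _ = 128 * Real.log N ^ 14 := by ring
        _ ≤ N := hpow
    have hθ : ellNorm 4 v ^ 4 - 3 / (N : ℝ) ≠ 0 := by
      refine abs_pos.1 (lt_of_lt_of_le (by positivity) hcθ)
    have h := measureReal_not_spectralErrorLE_le hn hnN v hL hL7 (le_of_max_le_left hN) hδ0 hδ1
      hθ hY
    refine le_trans (measureReal_mono (Set.compl_subset_compl.2 fun ω hgood => ?_)) h
    exact unit_bound hn hnN v hL hL7 hv hc hcθ hlog2 hbig hgood
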